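/- Let $n,d\ge 2$, $\{q_i\}_{i=1}^{2^d}=\{0,1\}^d$, $q_0=(\tfrac12,\dots,\tfrac12)\in\mathbb R^d$, and for $1\le i\le 2^d$, $1\le j\le n$ let $$F_{i,j}(x)=\frac{1}{2n-1}x+\frac{2n-2}{2n-1}\Big(\frac{n-j}{n-1}q_i+\frac{j-1}{n-1}q_0\Big).$$ Let $G_0=(V_0,E_0)$ be the complete graph on $V_0=\{q_i\}_{i=1}^{2^d}$, and for $m\ge1$ let $G_m=(V_m,E_m)$ with $V_m=\bigcup_{i,j}F_{i,j}V_{m-1}$ and $E_m=\{\{F_{i,j}x,F_{i,j}y\}:\{x,y\}\in E_{m-1},\,1\le i\le 2^d,\,1\le j\le n\}$. For $f:V_m\to\mathbb R$ put $\Delta_mf(x)=N_x^{-1}\sum_{y:\{x,y\}\in E_m}f(y)-f(x)$, where $N_x$ is the degree of $x$ in $G_m$. A real number $\lambda$ is a Neumann eigenvalue of $-\Delta_m$ if $-\Delta_mf=\lambda f$ at all points of $V_m$ (those of $V_0$ included) for some $f\ne0$; its multiplicity $M_{m,N}(\lambda)$ is the dimension of the space of all such $f$ (together with $0$), and $\sigma_{m,N}$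 is the set of Neumann eigenvalues. With $U_k$ the Chebyshev polynomials of the second kind and $t=1-(2^d-1)\lambda$, let $$R_{n,d}(\lambda)=1+(\lambda-1)U_{n-1}(t)^2+(t+\lambda+1)U_{n-1}(t)U_{n-2}(t)-t\,U_{n-2}(t)^2 .$$ Then for every $y\in[0,\frac{2^d}{2^d-1}]$ the equation $R_{n,d}(x)=y$ has exactly $2n-1$ real solutions $\psi_0(y)<\psi_1(y)<\dots<\psi_{2n-2}(y)$, and all of them lie in $[0,1]$. For a word $v=v_1\cdots v_k$ over $\{0,1,\dots,2n-2\}$ write $|v|=k$ and $\psi_v=\psi_{v_k}\circ\cdots\circ\psi_{v_1}$ ($\psi_\emptyset$ is the identity), and let $\Lambda_m$ be the set of such words with $|v|\le m$. For every $m\ge0$, $$\sigma_{m,N}=\Big\{\psi_v\big(\tfrac{2^d}{2^d-1}\big):v\in\Lambda_m,\ v=\emptyset\text{ or }v_1\in\{0,2,4,\dots,2n-4\}\Big\}\cup\Big\{\psi_v(0):v\in\Lambda_m,\ v=\emptyset\text{ or }v_1\in\{2,4,6,\dots,2n-2\}\Big\},$$ and the multiplicities are $$M_{m,N}\big(\psi_v(\tfrac{2^d}{2^d-1})\big)=(2^dn-2^d+1)^{m-|v|}(2^d-2)+1\quad\text{for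 }v\in\Lambda_m,\ v=\emptyset\text{ or }v_1\in\{0,2,\dots,2n-4\},$$ $$M_{m,N}(\psi_v(0))=1\quad\text{for }v\in\Lambda_m,\ v=\emptyset\text{ or }v_1\in\{2,4,\dots,2n-2\}.$$ -/

import Mathlib

noncomputable section

namespace Vicsek

/-- The vertex of the cube `[0,1]^d` with coordinates `ε ∈ {0,1}^d`. The corners of the cube are
indexed by their coordinates. -/
def corner {d : ℕ} (ε : Fin d → Fin 2) : Fin d → ℝ := fun k => ((ε k : ℕ) : ℝ)

/-- The center `(1/2, …, 1/2)` of the cube. -/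
def center (d : ℕ) : Fin d → ℝ := fun _ => 1 / 2

/-- The contraction `F_{i,j}` of the iterated function system (used for `1 ≤ j ≤ n`):
`F_{i,j}(x) = x/(2n-1) + (2n-2)/(2n-1) * ((n-j)/(n-1) q_i + (j-1)/(n-1) q_0)`. -/
def contraction (n : ℕ) {d : ℕ} (i : Fin d → Fin 2) (j : ℕ) (x : Fin d → ℝ) : Fin d → ℝ :=
  (1 / (2 * (n : ℝ) - 1)) • x +
    ((2 * (n : ℝ) - 2) / (2 * (n : ℝ) - 1)) •
      ((((n : ℝ) - j) / ((n : ℝ) - 1)) • corner i + (((j : ℝ) - 1) / ((n : ℝ) - 1)) • center d)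

/-- The vertex sets `V_m`. -/
def vertices (n d : ℕ) : ℕ → Set (Fin d → ℝ)
  | 0 => Set.range corner
  | m + 1 => ⋃ i : Fin d → Fin 2, ⋃ j ∈ Set.Icc 1 n, contraction n i j '' vertices n d m

/-- The edge sets `E_m`: `E_0` is the set of all pairs of distinct corners, and `E_{m+1}` is the
set of all images of edges of `E_m` under the contractions. -/
def edges (n d : ℕ) : ℕ → Set (Sym2 (Fin d → ℝ))
  | 0 => {e | ∃ i i' : Fin d → Fin 2, i ≠ i' ∧ e = s(corner i, corner i')}
  | m + 1 => ⋃ i : Fin d → Fin 2, ⋃ j ∈ Set.Icc 1 n, Sym2.map (contraction n i j) '' edges n d m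

/-- The level-`m` approximating graph `G_m = (V_m, E_m)`. -/
def graph (n d m : ℕ) : SimpleGraph (vertices n d m) :=
  (SimpleGraph.fromEdgeSet (edges n d m)).induce (vertices n d m)

theorem vertices_finite (n d m : ℕ) : (vertices n d m).Finite := by
  induction m with
  | zero => exact Set.finite_range _
  | succ m ih =>
    exact Set.finite_iUnion fun i => (Set.finite_Icc 1 n).biUnion fun j _ => ih.image _

instance (n d m : ℕ) : Finite (vertices n d m) := (vertices_finite n d m).to_subtype

instance (n d m : ℕ) : Fintype (vertices n d m) := Fintype.ofFinite _

open Classical in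
/-- The graph Laplacian `Δ_m f(x) = N_x⁻¹ ∑_{y ∼ x} f(y) - f(x)` on `l(V_m)`, where `N_x` is the
degree of `x` in `G_m`. -/
def laplacian (n d m : ℕ) : Module.End ℝ (vertices n d m → ℝ) where
  toFun f x :=
    (((graph n d m).degree x : ℝ)⁻¹ * (∑ y ∈ (graph n d m).neighborFinset x, f y)) - f x
  map_add' f g := by
    funext x
    simp only [Pi.add_apply, Finset.sum_add_distrib]
    ring
  map_smul' c f := by
    funext x
    simp only [Pi.smul_apply, smul_eq_mul, ← Finset.mul_sum, RingHom.id_apply]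
    ring

/-- The set `σ_{m,N}` of Neumann eigenvalues of `-Δ_m`: those real `μ` for which some nonzero `f`
satisfies `-Δ_m f(x) = μ f(x)` at every `x ∈ V_m`, boundary points included. -/
def neumannSpectrum (n d m : ℕ) : Set ℝ :=
  {μ | ∃ f : vertices n d m → ℝ, f ≠ 0 ∧ ∀ x, -(laplacian n d m f x) = μ * f x}

/-- The multiplicity of `μ` as a Neumann eigenvalue of `-Δ_m`: the dimension of the space of all
`f` with `-Δ_m f = μ f` on the whole of `V_m`. -/
def neumannMultiplicity (n d m : ℕ) (μ : ℝ) : ℕ :=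
  Module.finrank ℝ (Module.End.eigenspace (-laplacian n d m) μ)

open Polynomial in
/-- The substitution `t = 1 - (2^d - 1) λ`, as a polynomial in `λ`. -/
def tPoly (d : ℕ) : ℝ[X] := 1 - C ((2 : ℝ) ^ d - 1) * X

open Polynomial in
/-- The spectral decimation polynomial
`R_{n,d}(λ) = 1 + (λ-1) U_{n-1}(t)² + (t+λ+1) U_{n-1}(t) U_{n-2}(t) - t U_{n-2}(t)²`, where
`t = 1 - (2^d-1) λ` and `U` denotes the Chebyshev polynomials of the second kind. -/
def decimation (n d : ℕ) : ℝ[X] :=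
  1 + (X - 1) * ((Chebyshev.U ℝ ((n : ℤ) - 1)).comp (tPoly d)) ^ 2
    + (tPoly d + X + 1) * (Chebyshev.U ℝ ((n : ℤ) - 1)).comp (tPoly d)
        * (Chebyshev.U ℝ ((n : ℤ) - 2)).comp (tPoly d)
    - tPoly d * ((Chebyshev.U ℝ ((n : ℤ) - 2)).comp (tPoly d)) ^ 2

/-- The inverse branch `ψ_l`: `ψ_0(y), ψ_1(y), …` are the real solutions `x` of `R_{n,d}(x) = y`
listed in increasing order (with the value `0` when there is no `l`-th solution). -/
def branch (n d l : ℕ) (y : ℝ) : ℝ :=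
  ((decimation n d - Polynomial.C y).roots.toFinset.sort (· ≤ ·)).getD l 0

/-- The composition `ψ_v = ψ_{v_k} ∘ ⋯ ∘ ψ_{v_1}` for a word `v = v_1 ⋯ v_k` over the alphabet
`{0, …, 2n-2}`; `ψ_∅` is the identity. -/
def branchWord (n d : ℕ) (v : List (Fin (2 * n - 1))) (y : ℝ) : ℝ :=
  v.foldl (fun x l => branch n d l x) y

/-- `Λ_m`: the words of length at most `m` over the alphabet `{0, …, 2n-2}`. -/
def words (n m : ℕ) : Set (List (Fin (2 * n - 1))) := {v | v.length ≤ m}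

/-- The words that are empty or have first letter `v_1` in `{0, 2, 4, …, 2n-4}`. -/
def firstKind (n : ℕ) : Set (List (Fin (2 * n - 1))) :=
  {v | ∀ a ∈ v.head?, Even (a : ℕ) ∧ (a : ℕ) ≤ 2 * n - 4}

/-- The words that are empty or have first letter `v_1` in `{2, 4, 6, …, 2n-2}`. -/
def secondKind (n : ℕ) : Set (List (Fin (2 * n - 1))) :=
  {v | ∀ a ∈ v.head?, Even (a : ℕ) ∧ 2 ≤ (a : ℕ)}

end Vicsek

end

/-!
Spectral decimation. In the variable `t` the decimation polynomial factors as
`R(λ) = λ (U_{n-1} + U_{n-2}) (U_{n-1} + (2^d - 1) U_{n-2})`, and `2^d - (2^d - 1) R(λ)` is the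
product of `U_{n-1} - U_{n-2}` with a second factor. The signs of these factors at the points where
`t = cos (kπ / (2n - 1))` separate the solutions of `R(x) = y`.

Unless `x` is a zero of `U_{n-1} + U_{n-2}` or of that second factor, an eigenfunction on `V_m` for
`R(x)` extends to an eigenfunction on `V_{m+1}` for `x`: along each arm the eigenvalue equation is
the Chebyshev recurrence, and at the vertices of `V_m` the equations for `x` and `R(x)` are
proportional. Hence the multiplicity of `x` at level `m + 1` is at least that of `R(x)` at level
`m`. Starting from the constant functions, for `0`, and from the functions whose sum over every cell
vanishes, for `2^d / (2^d - 1)`, this bounds all multiplicities in the theorem from below by the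
claimed values. These values add up to the number of vertices, so the bounds are equalities and
there are no further eigenvalues.
-/

noncomputable section

namespace Vicsek

/-! ### Factors of the decimation polynomial -/

section Chebyshev

open Polynomial

theorem chebyshev_U_eval_add_one {R : Type*} [CommRing R] (k : ℤ) (t : R) :
    (Chebyshev.U R (k + 1)).eval t =
      2 * t * (Chebyshev.U R k).eval t - (Chebyshev.U R (k - 1)).eval t := by
  simp [Chebyshev.U_add_one]

theorem chebyshev_U_sq_add_sq {R : Type*} [CommRing R] (k : ℤ) :
    Chebyshev.U R k ^ 2 - 2 * X * Chebyshev.U R k * Chebyshev.U R (k - 1)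
      + Chebyshev.U R (k - 1) ^ 2 = 1 := by
  induction k with
  | zero => simp
  | succ k ih =>
    rw [Chebyshev.U_add_one, add_sub_cancel_right]
    linear_combination ih
  | pred k ih =>
    rw [Chebyshev.U_sub_one R (-k - 1), sub_add_cancel]
    linear_combination ih

theorem chebyshev_U_eval_sq_add_sq {R : Type*} [CommRing R] (k : ℤ) (t : R) :
    (Chebyshev.U R k).eval t ^ 2 - 2 * t * (Chebyshev.U R k).eval t * (Chebyshev.U R (k - 1)).eval t
      + (Chebyshev.U R (k - 1)).eval t ^ 2 = 1 := by
  simpa using congr_arg (eval t) (chebyshev_U_sq_add_sq (R := R) k)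

theorem neg_one_pow_mul_chebyshev_U_growth {t : ℝ} (ht : t ≤ -1) (k : ℕ) :
    1 ≤ (-1) ^ k * (Chebyshev.U ℝ k).eval t ∧
      (-2 * t - 1) * ((-1) ^ k * (Chebyshev.U ℝ k).eval t) + 1 ≤
        (-1) ^ (k + 1) * (Chebyshev.U ℝ (k + 1)).eval t ∧
      (-1) ^ (k + 1) * (Chebyshev.U ℝ (k + 1)).eval t ≤
        -2 * t * ((-1) ^ k * (Chebyshev.U ℝ k).eval t) := by
  induction k with
  | zero => norm_num
  | succ k ih =>
    obtain ⟨hone, hlower, -⟩ := ih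
    have hrec : (-1) ^ (k + 1 + 1) * (Chebyshev.U ℝ ((k + 1 : ℕ) + 1)).eval t =
        -2 * t * ((-1) ^ (k + 1) * (Chebyshev.U ℝ (k + 1 : ℕ)).eval t) -
          (-1) ^ k * (Chebyshev.U ℝ k).eval t := by
      rw [chebyshev_U_eval_add_one, Nat.cast_add_one, add_sub_cancel_right]
      ring
    rw [hrec]
    push_cast
    refine ⟨?_, ?_, ?_⟩ <;> nlinarith

theorem chebyshev_U_eval_cos_of_mul_eq {n k : ℕ} {θ : ℝ} (hθ : θ ∈ Set.Ioo 0 Real.pi)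
    (hk : (2 * n - 1) * θ = k * Real.pi) :
    (Chebyshev.U ℝ ((n : ℤ) - 2)).eval (Real.cos θ) =
      -((-1) ^ k * (Chebyshev.U ℝ ((n : ℤ) - 1)).eval (Real.cos θ)) := by
  have hpred := Chebyshev.U_real_cos θ (n - 2)
  have hself := Chebyshev.U_real_cos θ (n - 1)
  push_cast at hpred hself
  rw [show ((n : ℝ) - 1 + 1) * θ = n * θ by ring] at hself
  rw [show ((n : ℝ) - 2 + 1) * θ = k * Real.pi - n * θ by rw [← hk]; ring,
    Real.sin_nat_mul_pi_sub] at hpred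
  apply mul_right_cancel₀ (Real.sin_pos_of_mem_Ioo hθ).ne'
  rw [hpred, neg_mul, mul_assoc, hself]

theorem neg_one_pow_half_mul_sin_pos {φ : ℝ} (hφ : φ ∈ Set.Ioo 0 (Real.pi / 2)) (k : ℕ) :
    0 < (-1) ^ (k / 2) * Real.sin (φ + k * (Real.pi / 2)) := by
  have hsq (j : ℕ) : ((-1 : ℝ) ^ j) * (-1) ^ j = 1 := by rw [← mul_pow]; norm_num
  obtain ⟨j, rfl | rfl⟩ := Nat.even_or_odd' k
  · have hsin : Real.sin (φ + (2 * j : ℕ) * (Real.pi / 2)) = (-1) ^ j * Real.sin φ := by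
      rw [← Real.sin_add_nat_mul_pi]; push_cast; ring_nf
    rw [hsin, show 2 * j / 2 = j by omega, ← mul_assoc, hsq, one_mul]
    exact Real.sin_pos_of_pos_of_lt_pi hφ.1 (hφ.2.trans (half_lt_self Real.pi_pos))
  · have hsin : Real.sin (φ + (2 * j + 1 : ℕ) * (Real.pi / 2)) = (-1) ^ j * Real.cos φ := by
      rw [← Real.sin_add_pi_div_two, ← Real.sin_add_nat_mul_pi]; push_cast; ring_nf
    rw [hsin, show (2 * j + 1) / 2 = j by omega, ← mul_assoc, hsq, one_mul]
    exact Real.cos_pos_of_mem_Ioo ⟨by linarith [hφ.1, Real.pi_pos], hφ.2⟩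

theorem neg_one_pow_half_mul_chebyshev_U_cos_pos {n k : ℕ} {θ : ℝ} (hθ : θ ∈ Set.Ioo 0 Real.pi)
    (hk : (2 * n - 1) * θ = k * Real.pi) :
    0 < (-1) ^ (k / 2) * (Chebyshev.U ℝ ((n : ℤ) - 1)).eval (Real.cos θ) := by
  have hself := Chebyshev.U_real_cos θ (n - 1)
  push_cast at hself
  rw [show ((n : ℝ) - 1 + 1) * θ = θ / 2 + k * (Real.pi / 2) by linear_combination hk / 2] at hself
  refine pos_of_mul_pos_left ?_ (Real.sin_pos_of_mem_Ioo hθ).le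
  rw [mul_assoc, hself]
  exact neg_one_pow_half_mul_sin_pos ⟨by linarith [hθ.1], by linarith [hθ.2]⟩ k

end Chebyshev

section Factors

open Polynomial

/-- `W_{n-1}(t) = U_{n-1}(t) + U_{n-2}(t)`, a Chebyshev polynomial of the fourth kind. -/
def fourthKind (n : ℕ) (t : ℝ) : ℝ :=
  (Chebyshev.U ℝ ((n : ℤ) - 1)).eval t + (Chebyshev.U ℝ ((n : ℤ) - 2)).eval t

/-- `V_{n-1}(t) = U_{n-1}(t) - U_{n-2}(t)`, a Chebyshev polynomial of the third kind. -/
def thirdKind (n : ℕ) (t : ℝ) : ℝ :=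
  (Chebyshev.U ℝ ((n : ℤ) - 1)).eval t - (Chebyshev.U ℝ ((n : ℤ) - 2)).eval t

/-- The factor `U_{n-1}(t) + (q-1) U_{n-2}(t)` of the decimation polynomial, with `q = 2^d`. -/
def zeroFactor (q : ℝ) (n : ℕ) (t : ℝ) : ℝ :=
  (Chebyshev.U ℝ ((n : ℤ) - 1)).eval t + (q - 1) * (Chebyshev.U ℝ ((n : ℤ) - 2)).eval t

/-- The factor of `q - (q-1) R` complementary to `V_{n-1}`, with `q = 2^d`. In terms of Chebyshev
polynomials of the first kind it is `T_n(t) + (q-1) T_{n-1}(t)`. -/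
def topFactor (q : ℝ) (n : ℕ) (t : ℝ) : ℝ :=
  (q - 1 + t) * (Chebyshev.U ℝ ((n : ℤ) - 1)).eval t
    - (1 + (q - 1) * t) * (Chebyshev.U ℝ ((n : ℤ) - 2)).eval t

theorem continuous_zeroFactor (q : ℝ) (n : ℕ) : Continuous (zeroFactor q n) := by
  unfold zeroFactor; fun_prop

theorem continuous_topFactor (q : ℝ) (n : ℕ) : Continuous (topFactor q n) := by
  unfold topFactor; fun_prop

theorem thirdKind_mul_topFactor_add (q t : ℝ) (n : ℕ) :
    thirdKind n t * topFactor q n t + (1 - t) * (fourthKind n t * zeroFactor q n t) = q := by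
  have h := chebyshev_U_eval_sq_add_sq ((n : ℤ) - 1) t
  rw [sub_sub, one_add_one_eq_two] at h
  rw [thirdKind, topFactor, fourthKind, zeroFactor]
  linear_combination q * h

theorem chebyshev_U_eval_ne_zero_of_sq_eq {n : ℕ} {t : ℝ}
    (h : (Chebyshev.U ℝ ((n : ℤ) - 1)).eval t ^ 2 = (Chebyshev.U ℝ ((n : ℤ) - 2)).eval t ^ 2) :
    (Chebyshev.U ℝ ((n : ℤ) - 1)).eval t ≠ 0 := by
  intro hzero
  have hpell := chebyshev_U_eval_sq_add_sq ((n : ℤ) - 1) t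
  rw [sub_sub, one_add_one_eq_two, ← h, hzero] at hpell
  norm_num at hpell

theorem fourthKind_ne_zero_of_thirdKind {n : ℕ} {t : ℝ} (h : thirdKind n t = 0) :
    fourthKind n t ≠ 0 := by
  rw [thirdKind, sub_eq_zero] at h
  have hne := chebyshev_U_eval_ne_zero_of_sq_eq (congr_arg (· ^ 2) h)
  rw [fourthKind, ← h, ← two_mul]
  exact mul_ne_zero two_ne_zero hne

theorem topFactor_ne_zero_of_thirdKind {q t : ℝ} {n : ℕ} (hq : q ≠ 2) (ht : t ≠ 1)
    (h : thirdKind n t = 0) : topFactor q n t ≠ 0 := by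
  rw [thirdKind, sub_eq_zero] at h
  have hne := chebyshev_U_eval_ne_zero_of_sq_eq (congr_arg (· ^ 2) h)
  have hfactor : topFactor q n t = (q - 2) * (1 - t) * (Chebyshev.U ℝ ((n : ℤ) - 1)).eval t := by
    rw [topFactor, ← h]; ring
  rw [hfactor]
  exact mul_ne_zero (mul_ne_zero (sub_ne_zero.2 hq) (sub_ne_zero.2 ht.symm)) hne

theorem fourthKind_ne_zero_of_zeroFactor {q t : ℝ} {n : ℕ} (hq : q ≠ 2)
    (h : zeroFactor q n t = 0) : fourthKind n t ≠ 0 := by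
  intro hsum
  rw [fourthKind, add_eq_zero_iff_neg_eq] at hsum
  have hne := chebyshev_U_eval_ne_zero_of_sq_eq (n := n) (t := t) (by rw [← hsum, neg_sq])
  rw [zeroFactor, ← hsum] at h
  exact mul_ne_zero (sub_ne_zero.2 hq) hne (by linear_combination -h)

theorem four_le_two_pow {d : ℕ} (hd : 2 ≤ d) : (4 : ℝ) ≤ 2 ^ d := by
  calc (4 : ℝ) = 2 ^ 2 := by norm_num
    _ ≤ 2 ^ d := by gcongr; norm_num

end Factors

section Decimation

open Polynomial

theorem eval_tPoly (d : ℕ) (x : ℝ) : (tPoly d).eval x = 1 - (2 ^ d - 1) * x := by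
  simp [tPoly]

theorem decimation_eq_mul (n d : ℕ) :
    decimation n d = X *
      ((Chebyshev.U ℝ ((n : ℤ) - 1)).comp (tPoly d)
        + (Chebyshev.U ℝ ((n : ℤ) - 2)).comp (tPoly d)) *
      ((Chebyshev.U ℝ ((n : ℤ) - 1)).comp (tPoly d)
        + C (2 ^ d - 1) * (Chebyshev.U ℝ ((n : ℤ) - 2)).comp (tPoly d)) := by
  have hpell := congr_arg (comp · (tPoly d)) (chebyshev_U_sq_add_sq (R := ℝ) ((n : ℤ) - 1))
  simp only [sub_comp, add_comp, mul_comp, pow_comp, X_comp, one_comp, ofNat_comp] at hpell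
  rw [sub_sub, one_add_one_eq_two] at hpell
  rw [decimation]
  have ht : tPoly d = 1 - C (2 ^ d - 1) * X := rfl
  set t := tPoly d
  set a := (Chebyshev.U ℝ ((n : ℤ) - 1)).comp t
  set b := (Chebyshev.U ℝ ((n : ℤ) - 2)).comp t
  linear_combination -hpell - (a * b + b ^ 2) * ht

theorem decimation_eval (n d : ℕ) (x : ℝ) :
    (decimation n d).eval x =
      x * (fourthKind n ((tPoly d).eval x) * zeroFactor (2 ^ d) n ((tPoly d).eval x)) := by
  rw [decimation_eq_mul, fourthKind, zeroFactor]
  simp only [eval_mul, eval_add, eval_X, eval_C, eval_comp, mul_assoc]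

theorem mul_decimation_eval (n d : ℕ) (x : ℝ) :
    (2 ^ d - 1) * (decimation n d).eval x =
      2 ^ d - thirdKind n ((tPoly d).eval x) * topFactor (2 ^ d) n ((tPoly d).eval x) := by
  have hsum := thirdKind_mul_topFactor_add (2 ^ d) ((tPoly d).eval x) n
  have ht := eval_tPoly d x
  rw [decimation_eval]
  linear_combination
    hsum + fourthKind n ((tPoly d).eval x) * zeroFactor (2 ^ d) n ((tPoly d).eval x) * ht

theorem natDegree_decimation_le {n : ℕ} (hn : 2 ≤ n) (d : ℕ) :
    (decimation n d).natDegree ≤ 2 * n - 1 := by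
  have ht : (tPoly d).natDegree ≤ 1 := by unfold tPoly; compute_degree
  have hU (k : ℕ) : ((Chebyshev.U ℝ (k : ℤ)).comp (tPoly d)).natDegree ≤ k := by
    grw [natDegree_comp_le, Chebyshev.natDegree_U_natCast, ht, mul_one]
  have hself := hU (n - 1)
  have hpred := (hU (n - 2)).trans (show n - 2 ≤ n - 1 by omega)
  rw [show ((n - 1 : ℕ) : ℤ) = (n : ℤ) - 1 by omega] at hself
  rw [show ((n - 2 : ℕ) : ℤ) = (n : ℤ) - 2 by omega] at hpred
  rw [decimation_eq_mul]
  calc _ ≤ 1 + (n - 1) + (n - 1) := natDegree_mul_le_of_le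
        (natDegree_mul_le_of_le natDegree_X_le (natDegree_add_le_of_degree_le hself hpred))
        (natDegree_add_le_of_degree_le hself ((natDegree_C_mul_le _ _).trans hpred))
    _ = 2 * n - 1 := by omega

/-- The largest eigenvalue `2^d / (2^d - 1)` of the complete graph on `2^d` vertices. -/
def topValue (d : ℕ) : ℝ := 2 ^ d / (2 ^ d - 1)

theorem mul_topValue {d : ℕ} (hd : 2 ≤ d) : ((2 : ℝ) ^ d - 1) * topValue d = 2 ^ d :=
  mul_div_cancel₀ _ (by linarith [four_le_two_pow hd])

theorem one_lt_topValue {d : ℕ} (hd : 2 ≤ d) : 1 < topValue d := by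
  have := four_le_two_pow hd
  rw [topValue, lt_div_iff₀] <;> linarith

theorem topValue_lt_two {d : ℕ} (hd : 2 ≤ d) : topValue d < 2 := by
  have := four_le_two_pow hd
  rw [topValue, div_lt_iff₀] <;> linarith

theorem zero_mem_Icc_topValue {d : ℕ} (hd : 2 ≤ d) : (0 : ℝ) ∈ Set.Icc 0 (topValue d) :=
  Set.left_mem_Icc.2 (zero_lt_one.trans (one_lt_topValue hd)).le

theorem topValue_mem_Icc_topValue {d : ℕ} (hd : 2 ≤ d) : topValue d ∈ Set.Icc 0 (topValue d) :=
  Set.right_mem_Icc.2 (zero_lt_one.trans (one_lt_topValue hd)).le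

theorem decimation_eval_zero (n d : ℕ) : (decimation n d).eval 0 = 0 := by
  rw [decimation_eval, zero_mul]

theorem decimation_eval_eq_topValue_iff {d : ℕ} (hd : 2 ≤ d) (n : ℕ) (x : ℝ) :
    (decimation n d).eval x = topValue d ↔
      thirdKind n ((tPoly d).eval x) = 0 ∨ topFactor (2 ^ d) n ((tPoly d).eval x) = 0 := by
  have hq : (2 : ℝ) ^ d - 1 ≠ 0 := by linarith [four_le_two_pow hd]
  rw [← mul_right_inj' hq, mul_topValue hd, mul_decimation_eval, sub_eq_self, mul_eq_zero]

/-- `x` is not an exceptional value of spectral decimation: the eigenfunctions of `-Δ_m` for `R(x)`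
extend to eigenfunctions of `-Δ_{m+1}` for `x`. -/
def IsRegular (n d : ℕ) (x : ℝ) : Prop :=
  fourthKind n ((tPoly d).eval x) ≠ 0 ∧ topFactor (2 ^ d) n ((tPoly d).eval x) ≠ 0

theorem isRegular_of_decimation_mem_Ioo {n d : ℕ} (hd : 2 ≤ d) {x : ℝ}
    (hx : (decimation n d).eval x ∈ Set.Ioo 0 (topValue d)) : IsRegular n d x := by
  refine ⟨fun hzero => hx.1.ne' ?_, fun hzero => hx.2.ne ?_⟩
  · rw [decimation_eval, hzero, zero_mul, mul_zero]
  · exact (decimation_eval_eq_topValue_iff hd n x).2 (Or.inr hzero)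

theorem isRegular_of_thirdKind {n d : ℕ} (hd : 2 ≤ d) {x : ℝ} (hx : x ≠ 0)
    (h : thirdKind n ((tPoly d).eval x) = 0) : IsRegular n d x := by
  have hq := four_le_two_pow hd
  refine ⟨fourthKind_ne_zero_of_thirdKind h, topFactor_ne_zero_of_thirdKind (by linarith) ?_ h⟩
  rw [eval_tPoly, Ne, sub_eq_self]
  exact mul_ne_zero (by linarith) hx

theorem isRegular_of_zeroFactor {n d : ℕ} (hd : 2 ≤ d) {x : ℝ}
    (h : zeroFactor (2 ^ d) n ((tPoly d).eval x) = 0) : IsRegular n d x := by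
  refine ⟨fourthKind_ne_zero_of_zeroFactor (by linarith [four_le_two_pow hd]) h, fun htop => ?_⟩
  have hvalue := (decimation_eval_eq_topValue_iff hd n x).2 (Or.inr htop)
  rw [decimation_eval, h, mul_zero, mul_zero] at hvalue
  linarith [one_lt_topValue hd]

end Decimation

/-! ### Inverse branches -/

section Nodes

/-- The angles `kπ / (2n-1)` at whose cosines `V_{n-1}` (for odd `k`) and `W_{n-1}` (for even
`k > 0`) vanish. -/
def nodeAngle (n k : ℕ) : ℝ := k * Real.pi / (2 * n - 1)

/-- The points `(1 - cos (kπ / (2n-1))) / (2^d - 1)` for `k ≤ 2n-2`, where the decimation polynomial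
takes its extreme admissible values `0` and `2^d / (2^d - 1)` in turn, followed by the end point
`1`. They separate the inverse branches. -/
def node (n d k : ℕ) : ℝ :=
  if k ≤ 2 * n - 2 then (1 - Real.cos (nodeAngle n k)) / (2 ^ d - 1) else 1

theorem mul_nodeAngle {n : ℕ} (hn : 1 ≤ n) (k : ℕ) : (2 * n - 1) * nodeAngle n k = k * Real.pi := by
  have : (1 : ℝ) ≤ n := by exact_mod_cast hn
  exact mul_div_cancel₀ _ (by linarith)

theorem nodeAngle_mem_Ico {n k : ℕ} (hn : 1 ≤ n) (hk : k ≤ 2 * n - 2) :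
    nodeAngle n k ∈ Set.Ico 0 Real.pi := by
  have hn' : (1 : ℝ) ≤ n := by exact_mod_cast hn
  have hk' : (k : ℝ) + 2 ≤ 2 * n := by exact_mod_cast (by omega : k + 2 ≤ 2 * n)
  refine ⟨div_nonneg (by positivity) (by linarith), ?_⟩
  rw [nodeAngle, div_lt_iff₀ (by linarith)]
  nlinarith [Real.pi_pos]

theorem nodeAngle_strictMono {n : ℕ} (hn : 1 ≤ n) : StrictMono (nodeAngle n) := by
  intro k l hkl
  have hn' : (1 : ℝ) ≤ n := by exact_mod_cast hn
  have hkl' : (k : ℝ) < l := by exact_mod_cast hkl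
  unfold nodeAngle
  gcongr
  · linarith

theorem nodeAngle_mem_Ioo {n k : ℕ} (hn : 1 ≤ n) (hpos : 0 < k) (hk : k ≤ 2 * n - 2) :
    nodeAngle n k ∈ Set.Ioo 0 Real.pi :=
  ⟨(nodeAngle_mem_Ico hn (Nat.zero_le _)).1.trans_lt (nodeAngle_strictMono hn hpos),
    (nodeAngle_mem_Ico hn hk).2⟩

theorem eval_tPoly_node {n d k : ℕ} (hd : 2 ≤ d) (hk : k ≤ 2 * n - 2) :
    (tPoly d).eval (node n d k) = Real.cos (nodeAngle n k) := by
  have := four_le_two_pow hd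
  rw [eval_tPoly, node, if_pos hk, mul_div_cancel₀ _ (by linarith), sub_sub_cancel]

theorem node_zero (n d : ℕ) : node n d 0 = 0 := by simp [node, nodeAngle]

theorem node_last {n : ℕ} (hn : 1 ≤ n) (d : ℕ) : node n d (2 * n - 1) = 1 := by
  rw [node, if_neg (by omega)]

theorem node_lt_succ {n d k : ℕ} (hn : 1 ≤ n) (hd : 2 ≤ d) (hk : k < 2 * n - 1) :
    node n d k < node n d (k + 1) := by
  have hq := four_le_two_pow hd
  rw [node, node, if_pos (by omega)]
  split_ifs with hk'
  · have := Real.cos_lt_cos_of_nonneg_of_le_pi (nodeAngle_mem_Ico hn (k := k) (by omega)).1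
      (nodeAngle_mem_Ico hn hk').2.le (nodeAngle_strictMono hn k.lt_succ_self)
    gcongr
    linarith
  · rw [div_lt_one (by linarith)]
    linarith [Real.neg_one_le_cos (nodeAngle n k)]

theorem node_strictMonoOn {n d : ℕ} (hn : 1 ≤ n) (hd : 2 ≤ d) :
    StrictMonoOn (node n d) (Set.Iic (2 * n - 1)) :=
  strictMonoOn_of_lt_succ Set.ordConnected_Iic fun _ _ _ hk => node_lt_succ hn hd hk

theorem node_pos {n d k : ℕ} (hn : 1 ≤ n) (hd : 2 ≤ d) (hpos : 0 < k) (hk : k ≤ 2 * n - 1) :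
    0 < node n d k := by
  have := node_strictMonoOn hn hd (Set.mem_Iic.2 (Nat.zero_le _)) hk hpos
  rwa [node_zero] at this

end Nodes

section Signs

open Polynomial

theorem thirdKind_node {n d k : ℕ} (hd : 2 ≤ d) (hk : k ≤ 2 * n - 2) (ho : Odd k) :
    thirdKind n ((tPoly d).eval (node n d k)) = 0 := by
  have hn : 1 ≤ n := by have := ho.pos; omega
  rw [eval_tPoly_node hd hk, thirdKind,
    chebyshev_U_eval_cos_of_mul_eq (nodeAngle_mem_Ioo hn ho.pos hk) (mul_nodeAngle hn k),
    ho.neg_one_pow]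
  ring

theorem fourthKind_node {n d k : ℕ} (hd : 2 ≤ d) (hpos : 0 < k) (hk : k ≤ 2 * n - 2)
    (he : Even k) : fourthKind n ((tPoly d).eval (node n d k)) = 0 := by
  have hn : 1 ≤ n := by omega
  rw [eval_tPoly_node hd hk, fourthKind,
    chebyshev_U_eval_cos_of_mul_eq (nodeAngle_mem_Ioo hn hpos hk) (mul_nodeAngle hn k),
    he.neg_one_pow]
  ring

theorem zeroFactor_node_even {n d k : ℕ} (hd : 2 ≤ d) (hpos : 0 < k) (hk : k ≤ 2 * n - 2)
    (he : Even k) :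
    (-1) ^ (k / 2) * zeroFactor (2 ^ d) n ((tPoly d).eval (node n d k)) < 0 := by
  have hn : 1 ≤ n := by omega
  have hθ := nodeAngle_mem_Ioo hn hpos hk
  have hsign := neg_one_pow_half_mul_chebyshev_U_cos_pos hθ (mul_nodeAngle hn k)
  rw [eval_tPoly_node hd hk, zeroFactor,
    chebyshev_U_eval_cos_of_mul_eq hθ (mul_nodeAngle hn k), he.neg_one_pow]
  nlinarith [four_le_two_pow hd]

theorem zeroFactor_node_odd {n d k : ℕ} (hd : 2 ≤ d) (hk : k ≤ 2 * n - 2) (ho : Odd k) :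
    0 < (-1) ^ (k / 2) * zeroFactor (2 ^ d) n ((tPoly d).eval (node n d k)) := by
  have hn : 1 ≤ n := by have := ho.pos; omega
  have hθ := nodeAngle_mem_Ioo hn ho.pos hk
  have hsign := neg_one_pow_half_mul_chebyshev_U_cos_pos hθ (mul_nodeAngle hn k)
  rw [eval_tPoly_node hd hk, zeroFactor,
    chebyshev_U_eval_cos_of_mul_eq hθ (mul_nodeAngle hn k), ho.neg_one_pow]
  nlinarith [four_le_two_pow hd]

theorem topFactor_node {n d k : ℕ} (hd : 2 ≤ d) (hpos : 0 < k) (hk : k ≤ 2 * n - 2) :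
    0 < (-1) ^ (k / 2) * topFactor (2 ^ d) n ((tPoly d).eval (node n d k)) := by
  have hn : 1 ≤ n := by omega
  have hq := four_le_two_pow hd
  have hθ := nodeAngle_mem_Ioo hn hpos hk
  have hsign := neg_one_pow_half_mul_chebyshev_U_cos_pos hθ (mul_nodeAngle hn k)
  have hlt : Real.cos (nodeAngle n k) < 1 := by
    simpa using Real.cos_lt_cos_of_nonneg_of_le_pi le_rfl hθ.2.le hθ.1
  have hgt : -1 < Real.cos (nodeAngle n k) := by
    simpa using Real.cos_lt_cos_of_nonneg_of_le_pi hθ.1.le le_rfl hθ.2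
  rw [eval_tPoly_node hd hk, topFactor,
    chebyshev_U_eval_cos_of_mul_eq hθ (mul_nodeAngle hn k)]
  rcases Nat.even_or_odd k with he | ho
  · have hpos := mul_pos (mul_pos (zero_lt_four.trans_le hq) (neg_lt_iff_pos_add'.1 hgt)) hsign
    rw [he.neg_one_pow]
    linarith
  · have hpos := mul_pos (mul_pos (show (0 : ℝ) < 2 ^ d - 2 by linarith) (sub_pos.2 hlt)) hsign
    rw [ho.neg_one_pow]
    linarith

/-- Write `t = 2 - q`, `α = |U_{n-1}(t)|` and `β = |U_{n-2}(t)|`; the two values have opposite signs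
and `(2q-5) β + 1 ≤ α ≤ 2 (q-2) β`. -/
theorem factors_at_two_sub {q : ℝ} (hq : 4 ≤ q) {n : ℕ} (hn : 2 ≤ n) :
    2 < fourthKind n (2 - q) * zeroFactor q n (2 - q) ∧
      0 < (-1) ^ (n - 1) * zeroFactor q n (2 - q) ∧
      (-1) ^ (n - 1) * topFactor q n (2 - q) < 0 := by
  obtain ⟨k, rfl⟩ := Nat.exists_eq_add_of_le' hn
  obtain ⟨hβ, hlower, hupper⟩ :=
    neg_one_pow_mul_chebyshev_U_growth (t := 2 - q) (by linarith) k
  have hone : ((k + 2 : ℕ) : ℤ) - 1 = k + 1 := by push_cast; ring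
  have htwo : ((k + 2 : ℕ) : ℤ) - 2 = k := by push_cast; ring
  have hsq : ((-1 : ℝ) ^ k) ^ 2 = 1 := by rw [← pow_mul, mul_comm, pow_mul]; norm_num
  rw [fourthKind, zeroFactor, topFactor, hone, htwo, show k + 2 - 1 = k + 1 from rfl]
  rw [pow_succ] at hlower hupper ⊢
  set σ := (-1 : ℝ) ^ k
  set a := (Chebyshev.U ℝ (k + 1)).eval (2 - q)
  set b := (Chebyshev.U ℝ k).eval (2 - q)
  have hzero : 1 ≤ σ * -1 * (a + (q - 1) * b) := by nlinarith
  refine ⟨?_, by linarith, by nlinarith⟩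
  have hsum : 3 ≤ σ * -1 * (a + b) := by nlinarith
  nlinarith only [hsum, hzero, hsq]

theorem two_lt_decimation_eval_one {n d : ℕ} (hn : 2 ≤ n) (hd : 2 ≤ d) :
    2 < (decimation n d).eval 1 := by
  rw [decimation_eval, eval_tPoly, show (1 : ℝ) - (2 ^ d - 1) * 1 = 2 - 2 ^ d by ring, one_mul]
  exact (factors_at_two_sub (four_le_two_pow hd) hn).1

end Signs

section Branches

open Polynomial

theorem exists_mem_Ioo_eq_zero_of_mul_neg {f : ℝ → ℝ} (hf : Continuous f) {a b s : ℝ} (hab : a < b)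
    (ha : 0 < s * f a) (hb : s * f b < 0) : ∃ x ∈ Set.Ioo a b, f x = 0 := by
  obtain ⟨x, hx, hzero⟩ := intermediate_value_Ioo' hab.le (hf.const_mul s).continuousOn ⟨hb, ha⟩
  have hs : s ≠ 0 := left_ne_zero_of_mul ha.ne'
  exact ⟨x, hx, (mul_eq_zero.1 hzero).resolve_left hs⟩

theorem exists_topFactor_eq_zero {n d l : ℕ} (hn : 2 ≤ n) (hd : 2 ≤ d) (hl : l < 2 * n - 1)
    (h : Odd l ∨ l = 2 * n - 2) :
    ∃ x ∈ Set.Ioo (node n d l) (node n d (l + 1)),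
      topFactor (2 ^ d) n ((tPoly d).eval x) = 0 := by
  have hpos : 0 < l := h.elim Odd.pos (by omega)
  refine exists_mem_Ioo_eq_zero_of_mul_neg
    ((continuous_topFactor _ n).comp (tPoly d).continuous) (node_lt_succ (by omega) hd hl)
    (topFactor_node hd hpos (by omega)) ?_
  by_cases hlast : l = 2 * n - 2
  · subst hlast
    rw [show 2 * n - 2 + 1 = 2 * n - 1 by omega, node_last (by omega),
      show (2 * n - 2) / 2 = n - 1 by omega, Function.comp_apply, eval_tPoly,
      show (1 : ℝ) - (2 ^ d - 1) * 1 = 2 - 2 ^ d by ring]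
    exact (factors_at_two_sub (four_le_two_pow hd) hn).2.2
  · obtain ⟨j, rfl⟩ := h.resolve_right hlast
    have hsign := topFactor_node (n := n) hd (2 * j + 1).succ_pos (by omega)
    rw [show (2 * j + 1).succ / 2 = j + 1 by omega, pow_succ] at hsign
    rw [show (2 * j + 1) / 2 = j by omega]
    simpa using hsign

theorem exists_zeroFactor_eq_zero {n d l : ℕ} (hn : 2 ≤ n) (hd : 2 ≤ d) (hl : l < 2 * n - 1)
    (hpos : 0 < l) (he : Even l) :
    ∃ x ∈ Set.Ioo (node n d l) (node n d (l + 1)),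
      zeroFactor (2 ^ d) n ((tPoly d).eval x) = 0 := by
  refine exists_mem_Ioo_eq_zero_of_mul_neg (s := -(-1) ^ (l / 2))
    ((continuous_zeroFactor _ n).comp (tPoly d).continuous) (node_lt_succ (by omega) hd hl) ?_ ?_
  · rw [neg_mul, neg_pos]
    exact zeroFactor_node_even hd hpos (by omega) he
  rw [neg_mul, neg_neg_iff_pos, Function.comp_apply]
  obtain ⟨j, rfl⟩ := he.two_dvd
  by_cases hlast : 2 * j = 2 * n - 2
  · rw [show 2 * j + 1 = 2 * n - 1 by omega, node_last (by omega),
      show 2 * j / 2 = n - 1 by omega, eval_tPoly,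
      show (1 : ℝ) - (2 ^ d - 1) * 1 = 2 - 2 ^ d by ring]
    exact (factors_at_two_sub (four_le_two_pow hd) hn).2.1
  · have hsign := zeroFactor_node_odd (n := n) hd (by omega) (odd_two_mul_add_one j)
    rwa [show (2 * j + 1) / 2 = 2 * j / 2 by omega] at hsign

theorem decimation_node_even {n d k : ℕ} (hd : 2 ≤ d) (hk : k ≤ 2 * n - 2) (he : Even k) :
    (decimation n d).eval (node n d k) = 0 := by
  rcases k.eq_zero_or_pos with rfl | hpos
  · rw [node_zero, decimation_eval_zero]
  · rw [decimation_eval, fourthKind_node hd hpos hk he, zero_mul, mul_zero]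

theorem decimation_node_odd {n d k : ℕ} (hd : 2 ≤ d) (hk : k ≤ 2 * n - 2) (ho : Odd k) :
    (decimation n d).eval (node n d k) = topValue d :=
  (decimation_eval_eq_topValue_iff hd n _).2 (Or.inl (thirdKind_node hd hk ho))

theorem topValue_le_decimation_node_odd {n d k : ℕ} (hn : 2 ≤ n) (hd : 2 ≤ d) (hk : k ≤ 2 * n - 1)
    (ho : Odd k) : topValue d ≤ (decimation n d).eval (node n d k) := by
  by_cases hk' : k ≤ 2 * n - 2
  · exact (decimation_node_odd hd hk' ho).ge
  · rw [show k = 2 * n - 1 by omega, node_last (by omega)]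
    exact ((topValue_lt_two hd).trans (two_lt_decimation_eval_one hn hd)).le

/-- The interval from the `l`-th node to the next one, containing its left end point only for
`l = 0`; the value of the `l`-th inverse branch is the solution in this interval. -/
def branchInterval (n d l : ℕ) : Set ℝ :=
  {x | x ∈ Set.Icc (node n d l) (node n d (l + 1)) ∧ (x = node n d l → l = 0)}

theorem mem_branchInterval_of_mem_Ioo {n d l : ℕ} {x : ℝ}
    (hx : x ∈ Set.Ioo (node n d l) (node n d (l + 1))) : x ∈ branchInterval n d l :=
  ⟨Set.Ioo_subset_Icc_self hx, fun h => absurd h hx.1.ne'⟩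

theorem node_succ_mem_branchInterval {n d l : ℕ} (hn : 1 ≤ n) (hd : 2 ≤ d) (hl : l < 2 * n - 1) :
    node n d (l + 1) ∈ branchInterval n d l :=
  have hlt := node_lt_succ hn hd hl
  ⟨Set.right_mem_Icc.2 hlt.le, fun h => absurd h hlt.ne'⟩

theorem lt_of_mem_branchInterval {n d k l : ℕ} {x y : ℝ} (hn : 1 ≤ n) (hd : 2 ≤ d)
    (hl : l < 2 * n - 1) (hx : x ∈ branchInterval n d k) (hy : y ∈ branchInterval n d l)
    (hkl : k < l) : x < y := by
  have hne : node n d l ≠ y := fun h => absurd (hy.2 h.symm) (by omega)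
  have hnode := (node_strictMonoOn hn hd).monotoneOn
    (Set.mem_Iic.2 (by omega)) (Set.mem_Iic.2 hl.le) (Nat.succ_le_of_lt hkl)
  exact (hx.1.2.trans hnode).trans_lt (hy.1.1.lt_of_ne hne)

theorem branchInterval_subset_Icc {n d l : ℕ} (hn : 1 ≤ n) (hd : 2 ≤ d) (hl : l < 2 * n - 1) :
    branchInterval n d l ⊆ Set.Icc 0 1 := by
  intro x hx
  have hmono := (node_strictMonoOn hn hd).monotoneOn
  rw [← node_zero n d, ← node_last hn d]
  exact ⟨(hmono (Set.mem_Iic.2 (by omega)) (Set.mem_Iic.2 hl.le) (by omega)).trans hx.1.1,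
    hx.1.2.trans (hmono (Set.mem_Iic.2 hl) (Set.mem_Iic.2 le_rfl) hl)⟩

theorem exists_decimation_eq_zero {n d l : ℕ} (hn : 2 ≤ n) (hd : 2 ≤ d) (hl : l < 2 * n - 1) :
    ∃ x ∈ branchInterval n d l, (decimation n d).eval x = 0 := by
  rcases Nat.even_or_odd l with he | ho
  · rcases l.eq_zero_or_pos with rfl | hpos
    · refine ⟨0, ⟨?_, fun _ => rfl⟩, decimation_eval_zero n d⟩
      rw [node_zero]
      exact Set.left_mem_Icc.2 (node_pos (by omega) hd one_pos (by omega)).le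
    · obtain ⟨x, hx, hzero⟩ := exists_zeroFactor_eq_zero (d := d) hn hd hl hpos he
      exact ⟨x, mem_branchInterval_of_mem_Ioo hx, by rw [decimation_eval, hzero]; simp⟩
  · refine ⟨_, node_succ_mem_branchInterval (by omega) hd hl,
      decimation_node_even hd ?_ ho.add_one⟩
    obtain ⟨j, rfl⟩ := ho
    omega

theorem exists_decimation_eq_topValue {n d l : ℕ} (hn : 2 ≤ n) (hd : 2 ≤ d) (hl : l < 2 * n - 1) :
    ∃ x ∈ branchInterval n d l, (decimation n d).eval x = topValue d := by
  by_cases h : Odd l ∨ l = 2 * n - 2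
  · obtain ⟨x, hx, hzero⟩ := exists_topFactor_eq_zero (d := d) hn hd hl h
    exact ⟨x, mem_branchInterval_of_mem_Ioo hx,
      (decimation_eval_eq_topValue_iff hd n x).2 (Or.inr hzero)⟩
  · rw [not_or, Nat.not_odd_iff_even] at h
    exact ⟨_, node_succ_mem_branchInterval (by omega) hd hl,
      decimation_node_odd hd (by omega) h.1.add_one⟩

theorem exists_decimation_eq_of_mem_Ioo {n d l : ℕ} (hn : 2 ≤ n) (hd : 2 ≤ d) (hl : l < 2 * n - 1)
    {y : ℝ} (hy : y ∈ Set.Ioo 0 (topValue d)) :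
    ∃ x ∈ branchInterval n d l, (decimation n d).eval x = y := by
  have hle := (node_lt_succ (by omega) hd hl).le
  have hcont := (decimation n d).continuousOn (s := Set.Icc (node n d l) (node n d (l + 1)))
  suffices h : ∃ x ∈ Set.Ioo (node n d l) (node n d (l + 1)), (decimation n d).eval x = y by
    obtain ⟨x, hx, hxy⟩ := h
    exact ⟨x, mem_branchInterval_of_mem_Ioo hx, hxy⟩
  rcases Nat.even_or_odd l with he | ho
  · have hleft := decimation_node_even (d := d) hd (by omega : l ≤ 2 * n - 2) he
    have hright := topValue_le_decimation_node_odd hn hd (by omega : l + 1 ≤ 2 * n - 1) he.add_one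
    exact intermediate_value_Ioo hle hcont ⟨hleft.trans_lt hy.1, hy.2.trans_le hright⟩
  · have hleft := topValue_le_decimation_node_odd hn hd hl.le ho
    have hright := decimation_node_even (n := n) (d := d) (k := l + 1) hd
      (by obtain ⟨j, rfl⟩ := ho; omega) ho.add_one
    exact intermediate_value_Ioo' hle hcont ⟨hright.trans_lt hy.1, hy.2.trans_le hleft⟩

theorem exists_mem_branchInterval {n d l : ℕ} (hn : 2 ≤ n) (hd : 2 ≤ d) (hl : l < 2 * n - 1) {y : ℝ}
    (hy : y ∈ Set.Icc 0 (topValue d)) :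
    ∃ x ∈ branchInterval n d l, (decimation n d).eval x = y := by
  rcases hy.1.eq_or_lt with rfl | hpos
  · exact exists_decimation_eq_zero hn hd hl
  rcases hy.2.eq_or_lt with rfl | htop
  · exact exists_decimation_eq_topValue hn hd hl
  · exact exists_decimation_eq_of_mem_Ioo hn hd hl ⟨hpos, htop⟩

theorem range_eq_of_injective_of_card_le {α : Type*} {N : ℕ} {s : Finset α} {r : Fin N → α}
    (hr : r.Injective) (hmem : ∀ l, r l ∈ s) (hcard : s.card ≤ N) : Set.range r = s := by
  classical
  have himage : Finset.univ.image r = s := by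
    refine Finset.eq_of_subset_of_card_le (Finset.image_subset_iff.2 fun l _ => hmem l) ?_
    rwa [Finset.card_image_of_injective _ hr, Finset.card_univ, Fintype.card_fin]
  rw [← himage, Finset.coe_image, Finset.coe_univ, Set.image_univ]

theorem sort_getD_eq_of_strictMono {α : Type*} [LinearOrder α] {N : ℕ} {s : Finset α}
    {r : Fin N → α} (hr : StrictMono r) (hmem : ∀ l, r l ∈ s) (hcard : s.card ≤ N) (l : Fin N)
    (a : α) : (s.sort (· ≤ ·)).getD l a = r l := by
  have hcard' : s.card = N := by
    rw [← Set.ncard_coe_finset, ← range_eq_of_injective_of_card_le hr.injective hmem hcard,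
      Set.ncard_range_of_injective hr.injective, Nat.card_eq_fintype_card, Fintype.card_fin]
  have hlt : (l : ℕ) < (s.sort (· ≤ ·)).length := by rw [Finset.length_sort, hcard']; exact l.2
  rw [List.getD_eq_getElem _ _ hlt, Finset.orderEmbOfFin_unique hcard' hmem hr,
    Finset.orderEmbOfFin_apply]
  rfl

theorem decimation_sub_C_ne_zero {n d : ℕ} (hn : 2 ≤ n) (hd : 2 ≤ d) (y : ℝ) :
    decimation n d - C y ≠ 0 := by
  intro h
  rw [sub_eq_zero] at h
  have hzero := decimation_eval_zero n d
  have hone := two_lt_decimation_eval_one hn hd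
  rw [h, eval_C] at hzero hone
  linarith

theorem mem_roots_decimation_sub_C {n d : ℕ} (hn : 2 ≤ n) (hd : 2 ≤ d) {x y : ℝ} :
    x ∈ (decimation n d - C y).roots.toFinset ↔ (decimation n d).eval x = y := by
  rw [Multiset.mem_toFinset, mem_roots (decimation_sub_C_ne_zero hn hd y), IsRoot.def, eval_sub,
    eval_C, sub_eq_zero]

theorem card_roots_decimation_sub_C_le {n : ℕ} (hn : 2 ≤ n) (d : ℕ) (y : ℝ) :
    (decimation n d - C y).roots.toFinset.card ≤ 2 * n - 1 := by
  grw [Multiset.toFinset_card_le, card_roots', natDegree_sub_C, natDegree_decimation_le hn]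

theorem branch_spec {n d : ℕ} (hn : 2 ≤ n) (hd : 2 ≤ d) {y : ℝ} (hy : y ∈ Set.Icc 0 (topValue d)) :
    (∀ l : Fin (2 * n - 1), branch n d l y ∈ branchInterval n d l) ∧
      Set.range (fun l : Fin (2 * n - 1) => branch n d l y) =
        {x | (decimation n d).eval x = y} := by
  choose r hr heval using fun l : Fin (2 * n - 1) => exists_mem_branchInterval hn hd l.2 hy
  have hmono : StrictMono r := fun k l => lt_of_mem_branchInterval (by omega) hd l.2 (hr k) (hr l)
  have hmem (l) := (mem_roots_decimation_sub_C hn hd).2 (heval l)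
  have hcard := card_roots_decimation_sub_C_le hn d y
  have hbranch (l : Fin (2 * n - 1)) : branch n d l y = r l :=
    sort_getD_eq_of_strictMono hmono hmem hcard l 0
  simp only [hbranch]
  refine ⟨hr, (range_eq_of_injective_of_card_le hmono.injective hmem hcard).trans ?_⟩
  ext x
  exact mem_roots_decimation_sub_C hn hd

theorem branch_strictMono {n d : ℕ} (hn : 2 ≤ n) (hd : 2 ≤ d) {y : ℝ}
    (hy : y ∈ Set.Icc 0 (topValue d)) : StrictMono (fun l : Fin (2 * n - 1) => branch n d l y) :=
  fun k l => lt_of_mem_branchInterval (by omega) hd l.2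
    ((branch_spec hn hd hy).1 k) ((branch_spec hn hd hy).1 l)

theorem branch_mem_Icc {n d : ℕ} (hn : 2 ≤ n) (hd : 2 ≤ d) {y : ℝ}
    (hy : y ∈ Set.Icc 0 (topValue d)) (l : Fin (2 * n - 1)) : branch n d l y ∈ Set.Icc 0 1 :=
  branchInterval_subset_Icc (by omega) hd l.2 ((branch_spec hn hd hy).1 l)

theorem decimation_branch {n d : ℕ} (hn : 2 ≤ n) (hd : 2 ≤ d) {y : ℝ}
    (hy : y ∈ Set.Icc 0 (topValue d)) (l : Fin (2 * n - 1)) :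
    (decimation n d).eval (branch n d l y) = y :=
  (branch_spec hn hd hy).2.subset ⟨l, rfl⟩

theorem branch_eq_of_mem_branchInterval {n d : ℕ} (hn : 2 ≤ n) (hd : 2 ≤ d) {x y : ℝ}
    {l : Fin (2 * n - 1)} (hx : x ∈ branchInterval n d l) (hxy : (decimation n d).eval x = y)
    (hy : y ∈ Set.Icc 0 (topValue d)) : branch n d l y = x := by
  obtain ⟨hmem, hrange⟩ := branch_spec hn hd hy
  obtain ⟨k, rfl⟩ := hrange.superset hxy
  rcases lt_trichotomy l k with hlk | rfl | hkl
  · exact absurd (lt_of_mem_branchInterval (by omega) hd k.2 hx (hmem k) hlk) (lt_irrefl _)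
  · rfl
  · exact absurd (lt_of_mem_branchInterval (by omega) hd l.2 (hmem k) hx hkl) (lt_irrefl _)

theorem branch_eq_zero_iff {n d : ℕ} (hn : 2 ≤ n) (hd : 2 ≤ d) {y : ℝ}
    (hy : y ∈ Set.Icc 0 (topValue d)) (l : Fin (2 * n - 1)) :
    branch n d l y = 0 ↔ y = 0 ∧ (l : ℕ) = 0 := by
  obtain ⟨hmem, hnode⟩ := (branch_spec hn hd hy).1 l
  constructor
  · intro h
    have hl : (l : ℕ) = 0 := by
      by_contra hl
      have := node_pos (n := n) (by omega) hd (Nat.pos_of_ne_zero hl) l.2.le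
      linarith [hmem.1]
    rw [← decimation_branch hn hd hy l, h]
    exact ⟨decimation_eval_zero n d, hl⟩
  · rintro ⟨rfl, hl⟩
    refine branch_eq_of_mem_branchInterval hn hd ⟨?_, fun _ => hl⟩ (decimation_eval_zero n d) hy
    rw [hl, node_zero]
    exact Set.left_mem_Icc.2 (node_pos (by omega) hd one_pos (by omega)).le

theorem isRegular_branch_of_mem_Ioo {n d : ℕ} (hn : 2 ≤ n) (hd : 2 ≤ d) {y : ℝ}
    (hy : y ∈ Set.Ioo 0 (topValue d)) (l : Fin (2 * n - 1)) : IsRegular n d (branch n d l y) :=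
  isRegular_of_decimation_mem_Ioo hd
    ((decimation_branch hn hd (Set.Ioo_subset_Icc_self hy) l).symm ▸ hy)

theorem isRegular_branch_topValue {n d : ℕ} (hn : 2 ≤ n) (hd : 2 ≤ d) (l : Fin (2 * n - 1))
    (he : Even (l : ℕ)) (hl : (l : ℕ) ≤ 2 * n - 4) : IsRegular n d (branch n d l (topValue d)) := by
  have hbranch : branch n d l (topValue d) = node n d (l + 1) :=
    branch_eq_of_mem_branchInterval hn hd (node_succ_mem_branchInterval (by omega) hd l.2)
      (decimation_node_odd hd (by omega) he.add_one) (topValue_mem_Icc_topValue hd)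
  rw [hbranch]
  exact isRegular_of_thirdKind hd (node_pos (by omega) hd (Nat.succ_pos _) (by omega)).ne'
    (thirdKind_node hd (by omega) he.add_one)

theorem isRegular_branch_zero {n d : ℕ} (hn : 2 ≤ n) (hd : 2 ≤ d) (l : Fin (2 * n - 1))
    (he : Even (l : ℕ)) (hl : 2 ≤ (l : ℕ)) : IsRegular n d (branch n d l 0) := by
  obtain ⟨x, hx, hzero⟩ := exists_zeroFactor_eq_zero (d := d) hn hd l.2 (by omega) he
  rw [branch_eq_of_mem_branchInterval hn hd (mem_branchInterval_of_mem_Ioo hx)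
    (by rw [decimation_eval, hzero]; simp) (zero_mem_Icc_topValue hd)]
  exact isRegular_of_zeroFactor hd hzero

end Branches

/-! ### Words over the inverse branches -/

section Words

variable {n d : ℕ}

theorem branchWord_concat (n d : ℕ) (u : List (Fin (2 * n - 1))) (l : Fin (2 * n - 1)) (y : ℝ) :
    branchWord n d (u ++ [l]) y = branch n d l (branchWord n d u y) := by
  simp [branchWord, List.foldl_append]

theorem branchWord_mem_Icc (hn : 2 ≤ n) (hd : 2 ≤ d) (u : List (Fin (2 * n - 1))) {y : ℝ}
    (hy : y ∈ Set.Icc 0 (topValue d)) : branchWord n d u y ∈ Set.Icc 0 (topValue d) := by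
  induction u generalizing y with
  | nil => exact hy
  | cons a _ ih =>
    exact ih (Set.Icc_subset_Icc_right (one_lt_topValue hd).le (branch_mem_Icc hn hd hy a))

theorem branchWord_concat_lt_topValue (hn : 2 ≤ n) (hd : 2 ≤ d) (u : List (Fin (2 * n - 1)))
    (l : Fin (2 * n - 1)) {y : ℝ} (hy : y ∈ Set.Icc 0 (topValue d)) :
    branchWord n d (u ++ [l]) y < topValue d := by
  rw [branchWord_concat]
  exact (branch_mem_Icc hn hd (branchWord_mem_Icc hn hd u hy) l).2.trans_lt (one_lt_topValue hd)

theorem eq_zero_of_branchWord_eq_zero (hn : 2 ≤ n) (hd : 2 ≤ d) (u : List (Fin (2 * n - 1)))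
    {y : ℝ} (hy : y ∈ Set.Icc 0 (topValue d)) (h : branchWord n d u y = 0) :
    y = 0 ∧ ∀ a ∈ u.head?, (a : ℕ) = 0 := by
  induction u generalizing y with
  | nil => exact ⟨h, by simp⟩
  | cons a u ih =>
    have hzero : branch n d a y = 0 :=
      (ih (Set.Icc_subset_Icc_right (one_lt_topValue hd).le (branch_mem_Icc hn hd hy a)) h).1
    simpa using (branch_eq_zero_iff hn hd hy a).1 hzero

/-- The two eigenvalues of the complete graph `G_0`, from which all others are obtained by the
inverse branches: `2^d / (2^d - 1)` for `true` and `0` for `false`. -/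
def seed (d : ℕ) : Bool → ℝ
  | true => topValue d
  | false => 0

/-- The words allowed after each of the two values of `seed`. -/
def admissible (n : ℕ) : Bool → Set (List (Fin (2 * n - 1)))
  | true => firstKind n
  | false => secondKind n

theorem seed_mem_Icc (hd : 2 ≤ d) (s : Bool) : seed d s ∈ Set.Icc 0 (topValue d) := by
  cases s
  · exact zero_mem_Icc_topValue hd
  · exact topValue_mem_Icc_topValue hd

theorem nil_mem_admissible (n : ℕ) (s : Bool) : [] ∈ admissible n s := by
  cases s <;> simp [admissible, firstKind, secondKind]

theorem mem_admissible_of_concat {s : Bool} {u : List (Fin (2 * n - 1))} {l : Fin (2 * n - 1)}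
    (h : u ++ [l] ∈ admissible n s) : u ∈ admissible n s := by
  cases u with
  | nil => exact nil_mem_admissible n s
  | cons a u => cases s <;> simpa [admissible, firstKind, secondKind] using h

theorem branchWord_ne_zero (hn : 2 ≤ n) (hd : 2 ≤ d) {s : Bool} {u : List (Fin (2 * n - 1))}
    (h : u ∈ admissible n s) (hu : u ≠ []) : branchWord n d u (seed d s) ≠ 0 := by
  intro hzero
  obtain ⟨hseed, hhead⟩ := eq_zero_of_branchWord_eq_zero hn hd u (seed_mem_Icc hd s) hzero
  cases s with
  | true => exact (zero_lt_one.trans (one_lt_topValue hd)).ne' hseed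
  | false =>
    obtain ⟨a, u, rfl⟩ := List.exists_cons_of_ne_nil hu
    have h2 : 2 ≤ (a : ℕ) := (h a (by simp)).2
    have h0 : (a : ℕ) = 0 := hhead a (by simp)
    omega

theorem branchWord_ne_seed (hn : 2 ≤ n) (hd : 2 ≤ d) {s : Bool} {u : List (Fin (2 * n - 1))}
    (h : u ∈ admissible n s) (hu : u ≠ []) (s' : Bool) :
    branchWord n d u (seed d s) ≠ seed d s' := by
  cases s' with
  | false => exact branchWord_ne_zero hn hd h hu
  | true =>
    obtain ⟨w, l, rfl⟩ := List.eq_nil_or_concat' u |>.resolve_left hu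
    exact (branchWord_concat_lt_topValue hn hd w l (seed_mem_Icc hd s)).ne

theorem seed_injective (hd : 2 ≤ d) : Function.Injective (seed d) := by
  have := (zero_lt_one.trans (one_lt_topValue hd)).ne
  rintro (_ | _) (_ | _) h <;> simp_all [seed]

theorem branchWord_seed_injective (hn : 2 ≤ n) (hd : 2 ≤ d) {s s' : Bool}
    (v w : List (Fin (2 * n - 1))) (hv : v ∈ admissible n s) (hw : w ∈ admissible n s')
    (h : branchWord n d v (seed d s) = branchWord n d w (seed d s')) : s = s' ∧ v = w := by
  induction v using List.reverseRecOn generalizing w with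
  | nil =>
    by_cases hwnil : w = []
    · subst hwnil
      exact ⟨seed_injective hd h, rfl⟩
    · exact absurd h.symm (branchWord_ne_seed hn hd hw hwnil s)
  | append_singleton u l ih =>
    obtain rfl | ⟨w, l', rfl⟩ := List.eq_nil_or_concat' w
    · exact absurd h (branchWord_ne_seed hn hd hv (by simp) s')
    · rw [branchWord_concat, branchWord_concat] at h
      have hu := branchWord_mem_Icc hn hd u (seed_mem_Icc hd s)
      have hw' := branchWord_mem_Icc hn hd w (seed_mem_Icc hd s')
      have huw : branchWord n d u (seed d s) = branchWord n d w (seed d s') := by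
        rw [← decimation_branch hn hd hu l, h, decimation_branch hn hd hw' l']
      obtain ⟨rfl, rfl⟩ := ih w (mem_admissible_of_concat hv) (mem_admissible_of_concat hw) huw
      exact ⟨rfl, by rw [(branch_strictMono hn hd hu).injective h]⟩

theorem isRegular_branchWord_concat (hn : 2 ≤ n) (hd : 2 ≤ d) {s : Bool}
    {u : List (Fin (2 * n - 1))} {l : Fin (2 * n - 1)} (h : u ++ [l] ∈ admissible n s) :
    IsRegular n d (branchWord n d (u ++ [l]) (seed d s)) := by
  rw [branchWord_concat]
  by_cases hu : u = []
  · subst hu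
    cases s <;> obtain ⟨heven, hbound⟩ := h l (by simp)
    · exact isRegular_branch_zero hn hd l heven hbound
    · exact isRegular_branch_topValue hn hd l heven hbound
  · have hmem := branchWord_mem_Icc hn hd u (seed_mem_Icc hd s)
    have hne := branchWord_ne_seed hn hd (mem_admissible_of_concat h) hu
    exact isRegular_branch_of_mem_Ioo hn hd
      ⟨hmem.1.lt_of_ne (hne false).symm, hmem.2.lt_of_ne (hne true)⟩ l

/-- An index type for the admissible words of length at most `m`: a nonempty word of length
`k + 1` is given by one of the `n - 1` allowed first letters and `k` arbitrary letters. -/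
abbrev WordIndex (n m : ℕ) : Type :=
  Option (Σ k : Fin m, Fin (n - 1) × (Fin (k : ℕ) → Fin (2 * n - 1)))

/-- The `j`-th letter that may start an admissible word. -/
def firstLetter (n : ℕ) (s : Bool) (j : Fin (n - 1)) : Fin (2 * n - 1) :=
  ⟨2 * j + (if s then 0 else 2), by split <;> omega⟩

/-- The admissible word with a given index. -/
def indexWord (n m : ℕ) (s : Bool) : WordIndex n m → List (Fin (2 * n - 1))
  | none => []
  | some ⟨_, j, g⟩ => firstLetter n s j :: List.ofFn g

theorem indexWord_mem_admissible {m : ℕ} (s : Bool) (i : WordIndex n m) :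
    indexWord n m s i ∈ admissible n s := by
  rcases i with _ | ⟨k, j, g⟩
  · exact nil_mem_admissible n s
  · cases s <;> simp only [indexWord, admissible, firstKind, secondKind, Set.mem_ofPred_eq,
      List.head?_cons, Option.mem_def, Option.some.injEq, forall_eq', firstLetter]
    · exact ⟨by simp [parity_simps], by simp⟩
    · exact ⟨by simp, by simp; omega⟩

theorem indexWord_mem_words {m : ℕ} (s : Bool) (i : WordIndex n m) :
    indexWord n m s i ∈ words n m := by
  rcases i with _ | ⟨k, j, g⟩ <;> simp [indexWord, words]

theorem exists_firstLetter_eq (hn : 2 ≤ n) {s : Bool} {a : Fin (2 * n - 1)}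
    {u : List (Fin (2 * n - 1))} (h : a :: u ∈ admissible n s) : ∃ j, firstLetter n s j = a := by
  cases s <;> obtain ⟨⟨j, hj⟩, hbound⟩ := h a (by simp)
  · exact ⟨⟨j - 1, by omega⟩, by ext; simp [firstLetter]; omega⟩
  · exact ⟨⟨j, by omega⟩, by ext; simp [firstLetter]; omega⟩

theorem exists_indexWord_eq {m : ℕ} (hn : 2 ≤ n) {s : Bool} {v : List (Fin (2 * n - 1))}
    (hv : v ∈ admissible n s) (hm : v ∈ words n m) : ∃ i, indexWord n m s i = v := by
  cases v with
  | nil => exact ⟨none, rfl⟩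
  | cons a u =>
    obtain ⟨j, rfl⟩ := exists_firstLetter_eq hn hv
    exact ⟨some ⟨⟨u.length, by simpa [words] using hm⟩, j, u.get⟩, by simp [indexWord]⟩

theorem firstLetter_injective (n : ℕ) (s : Bool) : Function.Injective (firstLetter n s) := by
  intro j j' h
  simp only [firstLetter, Fin.mk.injEq] at h
  ext
  omega

theorem indexWord_injective (n m : ℕ) (s : Bool) : Function.Injective (indexWord n m s) := by
  rintro (_ | ⟨k, j, g⟩) (_ | ⟨k', j', g'⟩) h
  · rfl
  · simp [indexWord] at h
  · simp [indexWord] at h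
  · obtain ⟨hfirst, htail⟩ := List.cons.inj h
    obtain rfl : k = k' := Fin.ext (by simpa using congrArg List.length htail)
    rw [List.ofFn_injective htail, firstLetter_injective n s hfirst]

theorem sum_wordIndex (n m : ℕ) (s : Bool) (F : ℕ → ℕ) :
    ∑ i : WordIndex n m, F (indexWord n m s i).length =
      F 0 + ∑ k ∈ Finset.range m, (n - 1) * (2 * n - 1) ^ k * F (k + 1) := by
  rw [Fintype.sum_option, Fintype.sum_sigma, Finset.sum_range]
  simp [indexWord]

theorem sum_mul_pow_mul_add_one_add_sum {R : Type*} [CommRing R] {p q c a : R}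
    (hq : q - 1 = 2 * p) (hc : c - q = p * a) (m : ℕ) :
    ∑ k ∈ Finset.range m, p * q ^ k * (c ^ (m - (k + 1)) * a + 1)
      + ∑ k ∈ Finset.range m, p * q ^ k = c ^ m - 1 := by
  have hmixed := geom_sum₂_mul q c m
  have hgeom := geom_sum_mul q m
  have hsplit : ∑ k ∈ Finset.range m, p * q ^ k * (c ^ (m - (k + 1)) * a + 1) =
      (∑ k ∈ Finset.range m, q ^ k * c ^ (m - 1 - k)) * (p * a)
        + (∑ k ∈ Finset.range m, q ^ k) * p := by
    rw [Finset.sum_mul, Finset.sum_mul, ← Finset.sum_add_distrib]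
    refine Finset.sum_congr rfl fun k _ => ?_
    rw [show m - (k + 1) = m - 1 - k by omega]
    ring
  rw [hsplit, ← Finset.mul_sum]
  rw [hq] at hgeom
  rw [← neg_sub c q, hc] at hmixed
  linear_combination hgeom - hmixed

/-- The multiplicity of the eigenvalue that a word of length `k` produces from each value of
`seed`. -/
def predictedMultiplicity (n d m : ℕ) : Bool → ℕ → ℕ
  | true, k => (2 ^ d * n - 2 ^ d + 1) ^ (m - k) * (2 ^ d - 2) + 1
  | false, _ => 1

theorem sum_predictedMultiplicity (hn : 2 ≤ n) (hd : 2 ≤ d) (m : ℕ) :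
    ∑ si : Bool × WordIndex n m,
        predictedMultiplicity n d m si.1 (indexWord n m si.1 si.2).length =
      (2 ^ d * n - 2 ^ d + 1) ^ m * (2 ^ d - 1) + 1 := by
  rw [Fintype.sum_prod_type, Fintype.sum_bool,
    sum_wordIndex n m true (predictedMultiplicity n d m true),
    sum_wordIndex n m false (predictedMultiplicity n d m false)]
  simp only [predictedMultiplicity, mul_one, Nat.sub_zero]
  have hpow : 4 ≤ 2 ^ d := by exact_mod_cast four_le_two_pow hd
  have hcells : 2 ^ d ≤ 2 ^ d * n := Nat.le_mul_of_pos_right _ (by omega)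
  have hsum := sum_mul_pow_mul_add_one_add_sum (R := ℤ) (p := n - 1) (q := 2 * n - 1)
    (c := 2 ^ d * n - 2 ^ d + 1) (a := 2 ^ d - 2) (by ring) (by ring) m
  zify [show 1 ≤ n by omega, show 1 ≤ 2 * n by omega, show 1 ≤ 2 ^ d by omega,
    show 2 ≤ 2 ^ d by omega, hcells]
  linear_combination hsum

end Words

/-! ### Dimensions of eigenspaces -/

section EigenspaceCount

variable {K V ι : Type*} [Field K] [AddCommGroup V] [Module K V] [FiniteDimensional K V]
  [Fintype ι] {T : Module.End K V} {μ : ι → K}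

open Module (finrank)

theorem sum_finrank_eigenspace_le (T : Module.End K V) (hμ : Function.Injective μ) :
    ∑ i, finrank K (T.eigenspace (μ i)) ≤ finrank K V := by
  classical
  have hind := (Module.End.eigenspaces_iSupIndep T).comp hμ
  rw [← Module.finrank_directSum (R := K) fun i => T.eigenspace (μ i)]
  exact LinearMap.finrank_le_finrank_of_injective hind.dfinsupp_lsum_injective

theorem finrank_eigenspace_eq_of_finrank_le_sum (hμ : Function.Injective μ) {c : ι → ℕ}
    (hc : ∀ i, c i ≤ finrank K (T.eigenspace (μ i))) (hV : finrank K V ≤ ∑ i, c i) (i : ι) :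
    finrank K (T.eigenspace (μ i)) = c i :=
  ((Finset.sum_eq_sum_iff_of_le fun i _ => hc i).1
    ((Finset.sum_le_sum fun i _ => hc i).antisymm
      ((sum_finrank_eigenspace_le T hμ).trans hV)) i (Finset.mem_univ i)).symm

theorem mem_range_of_hasEigenvalue (hμ : Function.Injective μ)
    (hV : finrank K V ≤ ∑ i, finrank K (T.eigenspace (μ i))) {ν : K} (hν : T.HasEigenvalue ν) :
    ν ∈ Set.range μ := by
  by_contra hrange
  have hinj : Function.Injective fun o : Option ι => o.elim ν μ := by
    rintro (_ | i) (_ | j) h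
    · rfl
    · exact absurd ⟨j, h.symm⟩ hrange
    · exact absurd ⟨i, h⟩ hrange
    · exact congrArg some (hμ h)
  have hsum : finrank K (T.eigenspace ν) + ∑ i, finrank K (T.eigenspace (μ i)) ≤ finrank K V :=
    (Fintype.sum_option _).symm.trans_le (sum_finrank_eigenspace_le T hinj)
  have hpos : 1 ≤ finrank K (T.eigenspace ν) := Submodule.one_le_finrank_iff.2 hν
  omega

end EigenspaceCount

/-! ### Graphs partitioned into cliques -/

/-- A decomposition of the edge set of a graph into edge-disjoint complete graphs on the vertex
set `Q`, the *cells*, which are indexed by `W` and cover all vertices: `vert w e` is the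
`e`-th vertex of the cell `w`. -/
structure CliquePartition {V : Type*} (G : SimpleGraph V) (W Q : Type*) where
  vert : W → Q → V
  vert_injective : ∀ w, Function.Injective (vert w)
  exists_vert_eq : ∀ x, ∃ w e, vert w e = x
  adj_iff : ∀ {x y}, G.Adj x y ↔ ∃ w e e', e ≠ e' ∧ vert w e = x ∧ vert w e' = y
  eq_of_common_edge : ∀ {w w' e e' f f'}, e ≠ f → vert w e = vert w' e' →
    vert w f = vert w' f' → w = w'

namespace CliquePartition

variable {V W Q : Type*} {G : SimpleGraph V}

theorem degree_pos (P : CliquePartition G W Q) [Nontrivial Q] [G.LocallyFinite] (x : V) :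
    0 < G.degree x := by
  obtain ⟨w, e, rfl⟩ := P.exists_vert_eq x
  obtain ⟨e', he'⟩ := exists_ne e
  exact (G.degree_pos_iff_exists_adj _).2 ⟨_, P.adj_iff.2 ⟨w, e, e', he'.symm, rfl, rfl⟩⟩

variable (P : CliquePartition G W Q) [Fintype Q] {R : Type*} [CommRing R]

/-- The linear map sending a function on the vertices to its sums over the cells. -/
def cellSum (R : Type*) [CommRing R] : (V → R) →ₗ[R] (W → R) :=
  LinearMap.pi fun w => ∑ e, LinearMap.proj (P.vert w e)

theorem cellSum_apply (f : V → R) (w : W) : P.cellSum R f w = ∑ e, f (P.vert w e) := by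
  simp [cellSum]

variable [Fintype V] [Fintype W]

theorem card_le_card_add_finrank_ker_cellSum (K : Type*) [Field K] :
    Fintype.card V ≤ Fintype.card W + Module.finrank K (P.cellSum K).ker := by
  rw [← Module.finrank_fintype_fun_eq_card K (η := V), ← Module.finrank_fintype_fun_eq_card K,
    ← LinearMap.finrank_range_add_finrank_ker (P.cellSum K)]
  gcongr
  exact Submodule.finrank_le _

variable [G.LocallyFinite]

theorem sum_sum_neighborFinset [DecidableEq Q] {M : Type*} [AddCommMonoid M] (F : V → V → M) :
    ∑ x, ∑ y ∈ G.neighborFinset x, F x y =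
      ∑ w, ∑ e, ∑ e' ∈ Finset.univ.erase e, F (P.vert w e) (P.vert w e') := by
  simp only [Finset.sum_sigma']
  refine (Finset.sum_bij (fun p _ => ⟨P.vert p.1 p.2.1, P.vert p.1 p.2.2⟩) ?_ ?_ ?_ ?_).symm
  · rintro ⟨w, e, e'⟩ hp
    have hne : e' ≠ e := by simpa using hp
    simpa using P.adj_iff.2 ⟨w, e, e', hne.symm, rfl, rfl⟩
  · rintro ⟨w, e, e'⟩ hp ⟨w', f, f'⟩ - h
    have hne : e' ≠ e := by simpa using hp
    obtain ⟨hfst, hsnd⟩ := Sigma.mk.inj h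
    obtain rfl : w = w' := P.eq_of_common_edge hne.symm hfst (eq_of_heq hsnd)
    obtain rfl : e = f := P.vert_injective w hfst
    obtain rfl : e' = f' := P.vert_injective w (eq_of_heq hsnd)
    rfl
  · rintro ⟨x, y⟩ hxy
    obtain ⟨w, e, e', hne, rfl, rfl⟩ := P.adj_iff.1 (by simpa using hxy : G.Adj x y)
    exact ⟨⟨w, e, e'⟩, by simpa using hne.symm, rfl⟩
  · intros
    rfl

theorem sum_mul_sum_neighborFinset (φ f : V → R) :
    ∑ x, φ x * ∑ y ∈ G.neighborFinset x, f y =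
      ∑ w, ∑ e, φ (P.vert w e) * (P.cellSum R f w - f (P.vert w e)) := by
  classical
  simp only [Finset.mul_sum _ f, P.sum_sum_neighborFinset fun x y => φ x * f y, cellSum_apply]
  simp only [← Finset.mul_sum, Finset.sum_erase_eq_sub (Finset.mem_univ _), mul_sub]

theorem sum_mul_degree (φ : V → R) :
    ∑ x, φ x * G.degree x = (Fintype.card Q - 1) * ∑ w, ∑ e, φ (P.vert w e) := by
  have h := P.sum_mul_sum_neighborFinset φ 1
  simp only [Pi.one_apply, Finset.sum_const, SimpleGraph.card_neighborFinset_eq_degree,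
    nsmul_eq_mul, mul_one, cellSum_apply, Finset.card_univ] at h
  simp only [h, ← Finset.sum_mul]
  exact mul_comm _ _

/-- The sum, over all vertices of all cells, of a test function against the defect in one cell of
the eigenvalue equation. -/
def weakForm (μ : R) (f φ : V → R) : R :=
  ∑ w, ∑ e, φ (P.vert w e) *
    (P.cellSum R f w - (Fintype.card Q - (Fintype.card Q - 1) * μ) * f (P.vert w e))

theorem weakForm_eq (μ : R) (f φ : V → R) :
    P.weakForm μ f φ =
      ∑ x, φ x * (∑ y ∈ G.neighborFinset x, f y - (1 - μ) * G.degree x * f x) := by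
  have hsum := P.sum_mul_sum_neighborFinset φ f
  have hdeg := P.sum_mul_degree fun x => φ x * ((1 - μ) * f x)
  have hsplit : ∑ x, φ x * (∑ y ∈ G.neighborFinset x, f y - (1 - μ) * G.degree x * f x) =
      ∑ x, φ x * ∑ y ∈ G.neighborFinset x, f y - ∑ x, φ x * ((1 - μ) * f x) * G.degree x := by
    rw [← Finset.sum_sub_distrib]
    exact Finset.sum_congr rfl fun x _ => by ring
  rw [hsplit, hsum, hdeg, weakForm, Finset.mul_sum, ← Finset.sum_sub_distrib]
  refine Finset.sum_congr rfl fun w _ => ?_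
  rw [Finset.mul_sum, ← Finset.sum_sub_distrib]
  exact Finset.sum_congr rfl fun e _ => by ring

theorem forall_weakForm_eq_zero_iff {μ : R} {f : V → R} :
    (∀ φ, P.weakForm μ f φ = 0) ↔
      ∀ x, ∑ y ∈ G.neighborFinset x, f y = (1 - μ) * G.degree x * f x := by
  classical
  simp only [weakForm_eq]
  constructor
  · intro h x
    simpa [Pi.single_apply, sub_eq_zero] using h (Pi.single x 1)
  · intro h φ
    simp [h]

end CliquePartition

/-! ### Cells -/

section Cells

variable {n d : ℕ}

/-- Addresses of the cells of level one: `none` is the central cell, and `some (i, r)` is the cell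
on the arm towards the corner `i`, at distance `r + 1` from the center. -/
abbrev Letter (n d : ℕ) : Type := Option ((Fin d → Fin 2) × Fin (n - 1))

/-- The contraction onto the cell with address `a`. The central cell is the image of `F_{i,n}` for
every `i`. -/
def letterMap (n d : ℕ) : Letter n d → (Fin d → ℝ) → (Fin d → ℝ)
  | none => contraction n 0 n
  | some (i, r) => contraction n i (n - 1 - r)

/-- The position of the cell with address `a` in the grid of mesh `1/(2n-1)`. -/
def offset (n d : ℕ) : Letter n d → Fin d → ℤ
  | none, _ => n - 1
  | some (i, r), k => n - 1 + (2 * (i k : ℕ) - 1) * (r + 1)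

/-- The cell at distance `k` from the center on the arm towards the corner `i`, with the central
cell for `k = 0`. The value for `n ≤ k` is irrelevant. -/
def armLetter (i : Fin d → Fin 2) : ℕ → Letter n d
  | 0 => none
  | k + 1 => if h : k < n - 1 then some (i, ⟨k, h⟩) else none

/-- The distance of a cell of level one to the central cell. -/
def rank : Letter n d → ℕ
  | none => 0
  | some (_, r) => r + 1

/-- The corner opposite to `e`. -/
def opposite (e : Fin d → Fin 2) : Fin d → Fin 2 := fun k => 1 - e k

theorem fin_two_eq_zero_or_one (e : Fin 2) : e = 0 ∨ e = 1 := by omega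

theorem corner_opposite (e : Fin d → Fin 2) (k : Fin d) :
    corner (opposite e) k = 1 - corner e k := by
  rcases fin_two_eq_zero_or_one (e k) with h | h <;> simp [corner, opposite, h]

theorem opposite_ne (hd : 2 ≤ d) (e : Fin d → Fin 2) : opposite e ≠ e := by
  intro h
  have hcoord : 1 - e ⟨0, by omega⟩ = e ⟨0, by omega⟩ := congrFun h _
  omega

theorem corner_mem_Icc (e : Fin d → Fin 2) : corner e ∈ Set.Icc 0 1 := by
  constructor <;> intro k <;> rcases fin_two_eq_zero_or_one (e k) with h | h <;> simp [corner, h]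

theorem corner_injective (d : ℕ) : Function.Injective (corner (d := d)) := fun _ _ h =>
  funext fun k => Fin.ext (Nat.cast_injective (congrFun h k))

theorem armLetter_succ (i : Fin d → Fin 2) (r : Fin (n - 1)) :
    (armLetter i (r + 1) : Letter n d) = some (i, r) := by
  simp [armLetter]

theorem offset_armLetter (i : Fin d → Fin 2) {k : ℕ} (hk : k ≤ n - 1) (l : Fin d) :
    offset n d (armLetter i k) l = n - 1 + (2 * (i l : ℕ) - 1) * k := by
  cases k with
  | zero => simp [armLetter, offset]
  | succ k => simp [armLetter, offset, show k < n - 1 by omega]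

theorem offset_mem_Icc (hn : 2 ≤ n) (a : Letter n d) (k : Fin d) :
    (offset n d a k : ℝ) ∈ Set.Icc 0 (2 * (n : ℝ) - 2) := by
  obtain ⟨hlower, hupper⟩ : 0 ≤ offset n d a k ∧ offset n d a k + 2 ≤ 2 * n := by
    rcases a with _ | ⟨i, r⟩
    · simp only [offset]
      omega
    · rcases fin_two_eq_zero_or_one (i k) with h | h <;> simp [offset, h] <;> omega
  exact ⟨by exact_mod_cast hlower, le_sub_iff_add_le.2 (by exact_mod_cast hupper)⟩

theorem mul_letterMap_apply (hn : 2 ≤ n) (a : Letter n d) (x : Fin d → ℝ) (k : Fin d) :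
    (2 * (n : ℝ) - 1) * letterMap n d a x k = x k + offset n d a k := by
  have hn' : (2 : ℝ) ≤ n := by exact_mod_cast hn
  have hmesh : 2 * (n : ℝ) - 1 ≠ 0 := by linarith
  have harm : (n : ℝ) - 1 ≠ 0 := by linarith
  rcases a with _ | ⟨i, r⟩ <;>
    simp only [letterMap, contraction, offset, corner, center, Pi.add_apply, Pi.smul_apply,
      smul_eq_mul]
  · push_cast
    field_simp
    ring
  · have hr : ((n - 1 - (r : ℕ) : ℕ) : ℝ) = n - 1 - (r : ℕ) := by
      rw [Nat.cast_sub (by omega), Nat.cast_sub (by omega), Nat.cast_one]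
    rw [hr]
    push_cast
    field_simp
    ring

theorem letterMap_eq_iff (hn : 2 ≤ n) {a b : Letter n d} {x y : Fin d → ℝ} :
    letterMap n d a x = letterMap n d b y ↔
      ∀ k, x k + offset n d a k = y k + offset n d b k := by
  have hn' : (2 : ℝ) ≤ n := by exact_mod_cast hn
  have hmesh : 2 * (n : ℝ) - 1 ≠ 0 := by linarith
  simp only [funext_iff, ← mul_letterMap_apply hn, mul_right_inj' hmesh]

theorem letterMap_injective (hn : 2 ≤ n) (a : Letter n d) :
    Function.Injective (letterMap n d a) := fun _ _ h =>
  funext fun k => add_right_cancel ((letterMap_eq_iff hn).1 h k)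

theorem letterMap_mem_Icc (hn : 2 ≤ n) (a : Letter n d) {x : Fin d → ℝ}
    (hx : x ∈ Set.Icc 0 1) : letterMap n d a x ∈ Set.Icc 0 1 := by
  have hn' : (2 : ℝ) ≤ n := by exact_mod_cast hn
  have hmesh : 0 < 2 * (n : ℝ) - 1 := by linarith
  constructor <;> intro k <;> refine le_of_mul_le_mul_left ?_ hmesh <;>
    rw [mul_letterMap_apply hn a x k]
  · have : 0 ≤ x k := hx.1 k
    simpa using add_nonneg this (offset_mem_Icc hn a k).1
  · have : x k ≤ 1 := hx.2 k
    have := (offset_mem_Icc hn a k).2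
    simp only [Pi.one_apply]
    linarith

theorem eq_corner_of_letterMap_eq_corner (hn : 2 ≤ n) {a : Letter n d} {x : Fin d → ℝ}
    (hx : x ∈ Set.Icc 0 1) {e : Fin d → Fin 2} (h : letterMap n d a x = corner e) :
    x = corner e := by
  funext k
  have happly := mul_letterMap_apply hn a x k
  have hoffset := offset_mem_Icc hn a k
  have hlower : 0 ≤ x k := hx.1 k
  have hupper : x k ≤ 1 := hx.2 k
  rw [h] at happly
  rcases fin_two_eq_zero_or_one (e k) with he | he <;> simp [corner, he] at happly ⊢ <;>
    linarith [hoffset.1, hoffset.2]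

theorem letterMap_opposite (hn : 2 ≤ n) (i : Fin d → Fin 2) (r : Fin (n - 1)) :
    letterMap n d (some (i, r)) (corner (opposite i)) =
      letterMap n d (armLetter i r) (corner i) := by
  rw [letterMap_eq_iff hn]
  intro k
  rw [corner_opposite, offset_armLetter i r.2.le]
  simp only [offset, corner]
  push_cast
  ring

theorem letterMap_outer (hn : 2 ≤ n) (i : Fin d → Fin 2) :
    letterMap n d (armLetter i (n - 1)) (corner i) = corner i := by
  have hn' : (2 : ℝ) ≤ n := by exact_mod_cast hn
  have hmesh : 2 * (n : ℝ) - 1 ≠ 0 := by linarith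
  funext k
  refine mul_left_cancel₀ hmesh ?_
  rw [mul_letterMap_apply hn, offset_armLetter i le_rfl, corner]
  push_cast [Nat.cast_sub (show 1 ≤ n by omega)]
  ring

theorem arm_eq_of_letterMap_eq (hn : 2 ≤ n) {i j : Fin d → Fin 2} {r s : Fin (n - 1)}
    {x y : Fin d → ℝ} (hx : x ∈ Set.Icc 0 1) (hy : y ∈ Set.Icc 0 1)
    (h : letterMap n d (some (i, r)) x = letterMap n d (some (j, s)) y) : i = j := by
  funext k
  have hk := (letterMap_eq_iff hn).1 h k
  have hx0 : 0 ≤ x k := hx.1 k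
  have hx1 : x k ≤ 1 := hx.2 k
  have hy0 : 0 ≤ y k := hy.1 k
  have hy1 : y k ≤ 1 := hy.2 k
  have hr : (0 : ℝ) ≤ (r : ℕ) := Nat.cast_nonneg _
  have hs : (0 : ℝ) ≤ (s : ℕ) := Nat.cast_nonneg _
  simp only [offset] at hk
  push_cast at hk
  rcases fin_two_eq_zero_or_one (i k) with hi | hi <;>
    rcases fin_two_eq_zero_or_one (j k) with hj | hj <;> rw [hi, hj] at hk ⊢ <;>
    exfalso <;> norm_num at hk <;> linarith [hr, hs]

theorem eq_corner_of_letterMap_eq_armLetter (hn : 2 ≤ n) (hd : 2 ≤ d) {i : Fin d → Fin 2}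
    {r : Fin (n - 1)} {k : ℕ} (hk : k ≤ r) {x y : Fin d → ℝ} (hx : x ∈ Set.Icc 0 1)
    (hy : y ∈ Set.Icc 0 1)
    (h : letterMap n d (some (i, r)) x = letterMap n d (armLetter i k) y) :
    k = r ∧ x = corner (opposite i) ∧ y = corner i := by
  have hcoord (l : Fin d) :
      (r : ℝ) ≤ k ∧ (k = r → x l = corner (opposite i) l ∧ y l = corner i l) := by
    have hl := (letterMap_eq_iff hn).1 h l
    rw [offset_armLetter i (hk.trans r.2.le), offset] at hl
    push_cast at hl
    have hx0 : 0 ≤ x l := hx.1 l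
    have hx1 : x l ≤ 1 := hx.2 l
    have hy0 : 0 ≤ y l := hy.1 l
    have hy1 : y l ≤ 1 := hy.2 l
    rw [corner_opposite]
    have hcorner : corner i l = 0 ∨ corner i l = 1 := by
      rcases fin_two_eq_zero_or_one (i l) with hi | hi <;> simp [corner, hi]
    change x l + (n - 1 + (2 * corner i l - 1) * (r + 1)) =
      y l + (n - 1 + (2 * corner i l - 1) * k) at hl
    rcases hcorner with hc | hc <;> rw [hc] at hl ⊢ <;>
      refine ⟨by linarith, fun hkr => ?_⟩ <;> rw [hkr] at hl <;> constructor <;> linarith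
  have hkr : k = r := hk.antisymm (by exact_mod_cast (hcoord ⟨0, by omega⟩).1)
  exact ⟨hkr, funext fun l => ((hcoord l).2 hkr).1, funext fun l => ((hcoord l).2 hkr).2⟩

theorem letterMap_eq_letterMap (hn : 2 ≤ n) (hd : 2 ≤ d) {a b : Letter n d} (hab : a ≠ b)
    (hrank : rank b ≤ rank a) {x y : Fin d → ℝ} (hx : x ∈ Set.Icc 0 1) (hy : y ∈ Set.Icc 0 1)
    (h : letterMap n d a x = letterMap n d b y) :
    ∃ i r, a = some (i, r) ∧ b = armLetter i r ∧ x = corner (opposite i) ∧ y = corner i := by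
  rcases a with _ | ⟨i, r⟩
  · rcases b with _ | ⟨j, s⟩
    · exact absurd rfl hab
    · simp [rank] at hrank
  have hb : b = armLetter i (rank b) := by
    rcases b with _ | ⟨j, s⟩
    · rfl
    · rw [arm_eq_of_letterMap_eq hn hx hy h, rank, armLetter_succ]
  have hle : rank b ≤ r := by
    refine Nat.lt_succ_iff.1 (hrank.lt_of_ne fun heq => hab ?_)
    rw [hb, heq, rank, armLetter_succ]
  obtain ⟨hr, hxy⟩ := eq_corner_of_letterMap_eq_armLetter hn hd hle hx hy (hb ▸ h)
  exact ⟨i, r, rfl, hr ▸ hb, hxy⟩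

theorem exists_corners_of_letterMap_eq (hn : 2 ≤ n) (hd : 2 ≤ d) {a b : Letter n d}
    (hab : a ≠ b) : ∃ e e' : Fin d → Fin 2, ∀ x ∈ Set.Icc 0 1, ∀ y ∈ Set.Icc 0 1,
      letterMap n d a x = letterMap n d b y → x = corner e ∧ y = corner e' := by
  wlog hrank : rank b ≤ rank a generalizing a b
  · obtain ⟨e, e', h⟩ := this hab.symm (Nat.le_of_not_le hrank)
    exact ⟨e', e, fun x hx y hy hxy => (h y hy x hx hxy.symm).symm⟩
  rcases a with _ | ⟨i, r⟩
  · refine ⟨0, 0, fun x hx y hy h => ?_⟩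
    obtain ⟨i, r, hnone, -⟩ := letterMap_eq_letterMap hn hd hab hrank hx hy h
    cases hnone
  · refine ⟨opposite i, i, fun x hx y hy h => ?_⟩
    obtain ⟨i, r, ⟨⟩, -, hxy⟩ := letterMap_eq_letterMap hn hd hab hrank hx hy h
    exact hxy

/-- The map onto the cell of level `m` with address `w`. -/
def cellMap (n d m : ℕ) (w : Fin m → Letter n d) (x : Fin d → ℝ) : Fin d → ℝ :=
  (List.ofFn w).foldr (letterMap n d) x

theorem cellMap_cons (n d m : ℕ) (a : Letter n d) (w : Fin m → Letter n d) (x : Fin d → ℝ) :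
    cellMap n d (m + 1) (Fin.cons a w) x = letterMap n d a (cellMap n d m w x) := by
  simp [cellMap, List.ofFn_succ]

theorem cellMap_snoc (n d m : ℕ) (w : Fin m → Letter n d) (a : Letter n d) (x : Fin d → ℝ) :
    cellMap n d (m + 1) (Fin.snoc w a) x = cellMap n d m w (letterMap n d a x) := by
  simp only [cellMap, List.ofFn_succ', List.concat_eq_append, List.foldr_append, Fin.snoc_castSucc,
    Fin.snoc_last, List.foldr_cons, List.foldr_nil]

theorem cellMap_mem_Icc (hn : 2 ≤ n) {m : ℕ} (w : Fin m → Letter n d) {x : Fin d → ℝ}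
    (hx : x ∈ Set.Icc 0 1) : cellMap n d m w x ∈ Set.Icc 0 1 := by
  induction w using Fin.consInduction with
  | elim0 => simpa [cellMap] using hx
  | cons a w ih => exact cellMap_cons n d _ a w x ▸ letterMap_mem_Icc hn a ih

theorem cellMap_injective (hn : 2 ≤ n) {m : ℕ} (w : Fin m → Letter n d) :
    Function.Injective (cellMap n d m w) := by
  induction w using Fin.consInduction with
  | elim0 => exact fun x y h => by simpa [cellMap] using h
  | cons a w ih =>
    intro x y h
    rw [cellMap_cons, cellMap_cons] at h
    exact ih (letterMap_injective hn a h)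

theorem eq_corner_of_cellMap_eq_corner (hn : 2 ≤ n) {m : ℕ} {w : Fin m → Letter n d}
    {x : Fin d → ℝ} (hx : x ∈ Set.Icc 0 1) {e : Fin d → Fin 2}
    (h : cellMap n d m w x = corner e) : x = corner e := by
  induction w using Fin.consInduction with
  | elim0 => simpa [cellMap] using h
  | cons a w ih =>
    rw [cellMap_cons] at h
    exact ih (eq_corner_of_letterMap_eq_corner hn (cellMap_mem_Icc hn w hx) h)

theorem exists_corners_of_cellMap_eq (hn : 2 ≤ n) (hd : 2 ≤ d) {m : ℕ}
    {w w' : Fin m → Letter n d} (hw : w ≠ w') :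
    ∃ e e' : Fin d → Fin 2, ∀ x ∈ Set.Icc 0 1, ∀ y ∈ Set.Icc 0 1,
      cellMap n d m w x = cellMap n d m w' y → x = corner e ∧ y = corner e' := by
  induction w using Fin.consInduction with
  | elim0 => exact absurd (Subsingleton.elim _ _) hw
  | cons a w ih =>
    obtain ⟨a', w', rfl⟩ : ∃ a' v', w' = Fin.cons a' v' := ⟨_, _, (Fin.cons_self_tail w').symm⟩
    simp only [cellMap_cons]
    by_cases ha : a = a'
    · subst ha
      obtain ⟨e, e', h⟩ := ih (w' := w') fun heq => hw (heq ▸ rfl)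
      exact ⟨e, e', fun x hx y hy hxy => h x hx y hy (letterMap_injective hn a hxy)⟩
    · obtain ⟨e, e', h⟩ := exists_corners_of_letterMap_eq hn hd ha
      refine ⟨e, e', fun x hx y hy hxy => ?_⟩
      obtain ⟨hx', hy'⟩ := h _ (cellMap_mem_Icc hn w hx) _ (cellMap_mem_Icc hn w' hy) hxy
      exact ⟨eq_corner_of_cellMap_eq_corner hn hx hx', eq_corner_of_cellMap_eq_corner hn hy hy'⟩

end Cells

/-! ### The graphs `G_m` -/

section Vertices

variable {n d : ℕ}

theorem contraction_self (i : Fin d → Fin 2) : contraction n i n = letterMap n d none := by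
  funext x
  simp [letterMap, contraction]

theorem exists_letterMap_eq_contraction (i : Fin d → Fin 2) {j : ℕ} (hj : j ∈ Set.Icc 1 n) :
    ∃ a, letterMap n d a = contraction n i j := by
  obtain ⟨hpos, hle⟩ := hj
  rcases hle.eq_or_lt with rfl | hlt
  · exact ⟨none, (contraction_self i).symm⟩
  · refine ⟨some (i, ⟨n - 1 - j, by omega⟩), ?_⟩
    rw [letterMap, Nat.sub_sub_self (by omega)]

theorem exists_contraction_eq_letterMap (hn : 2 ≤ n) (a : Letter n d) :
    ∃ i, ∃ j ∈ Set.Icc 1 n, contraction n i j = letterMap n d a := by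
  rcases a with _ | ⟨i, r⟩
  · exact ⟨0, n, ⟨by omega, le_rfl⟩, rfl⟩
  · exact ⟨i, n - 1 - r, ⟨by omega, by omega⟩, rfl⟩

theorem mem_vertices_succ (hn : 2 ≤ n) {m : ℕ} {x : Fin d → ℝ} :
    x ∈ vertices n d (m + 1) ↔ ∃ a, ∃ v ∈ vertices n d m, letterMap n d a v = x := by
  simp only [vertices, Set.mem_iUnion, Set.mem_image]
  constructor
  · rintro ⟨i, j, hj, v, hv, rfl⟩
    obtain ⟨a, ha⟩ := exists_letterMap_eq_contraction i hj
    exact ⟨a, v, hv, congrFun ha v⟩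
  · rintro ⟨a, v, hv, rfl⟩
    obtain ⟨i, j, hj, ha⟩ := exists_contraction_eq_letterMap hn a
    exact ⟨i, j, hj, v, hv, congrFun ha v⟩

theorem mem_vertices_iff (hn : 2 ≤ n) {m : ℕ} {x : Fin d → ℝ} :
    x ∈ vertices n d m ↔ ∃ w e, cellMap n d m w (corner e) = x := by
  induction m generalizing x with
  | zero =>
    simp only [vertices, Set.mem_range, cellMap, List.ofFn_zero, List.foldr_nil]
    exact ⟨fun ⟨e, h⟩ => ⟨Fin.elim0, e, h⟩, fun ⟨_, e, h⟩ => ⟨e, h⟩⟩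
  | succ m ih =>
    simp only [mem_vertices_succ hn, ih, Fin.exists_fin_succ_pi, cellMap_cons]
    constructor
    · rintro ⟨a, _, ⟨w, e, rfl⟩, rfl⟩
      exact ⟨a, w, e, rfl⟩
    · rintro ⟨a, w, e, rfl⟩
      exact ⟨a, _, ⟨w, e, rfl⟩, rfl⟩

theorem mem_edges_iff (hn : 2 ≤ n) {m : ℕ} {s : Sym2 (Fin d → ℝ)} :
    s ∈ edges n d m ↔ ∃ w e e', e ≠ e' ∧
      s = s(cellMap n d m w (corner e), cellMap n d m w (corner e')) := by
  induction m generalizing s with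
  | zero =>
    simp only [edges, Set.mem_ofPred_eq, cellMap, List.ofFn_zero, List.foldr_nil]
    exact ⟨fun ⟨e, h⟩ => ⟨Fin.elim0, e, h⟩, fun ⟨_, e, h⟩ => ⟨e, h⟩⟩
  | succ m ih =>
    simp only [edges, Set.mem_iUnion, Set.mem_image, ih, Fin.exists_fin_succ_pi, cellMap_cons]
    constructor
    · rintro ⟨i, j, hj, _, ⟨w, e, e', hne, rfl⟩, rfl⟩
      obtain ⟨a, ha⟩ := exists_letterMap_eq_contraction i hj
      exact ⟨a, w, e, e', hne, by rw [Sym2.map_mk, ha]⟩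
    · rintro ⟨a, w, e, e', hne, rfl⟩
      obtain ⟨i, j, hj, ha⟩ := exists_contraction_eq_letterMap hn a
      exact ⟨i, j, hj, _, ⟨w, e, e', hne, rfl⟩, by rw [Sym2.map_mk, ha]⟩

theorem corner_mem_vertices (hn : 2 ≤ n) (m : ℕ) (e : Fin d → Fin 2) :
    corner e ∈ vertices n d m := by
  induction m with
  | zero => exact ⟨e, rfl⟩
  | succ m ih => exact (mem_vertices_succ hn).2 ⟨_, _, ih, letterMap_outer hn e⟩

theorem vertices_subset_Icc (hn : 2 ≤ n) (m : ℕ) : vertices n d m ⊆ Set.Icc 0 1 := by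
  intro x hx
  obtain ⟨w, e, rfl⟩ := (mem_vertices_iff hn).1 hx
  exact cellMap_mem_Icc hn w (corner_mem_Icc e)

theorem vertices_subset_succ (hn : 2 ≤ n) (m : ℕ) : vertices n d m ⊆ vertices n d (m + 1) := by
  intro x hx
  obtain ⟨w, e, rfl⟩ := (mem_vertices_iff hn).1 hx
  exact (mem_vertices_iff hn).2
    ⟨Fin.snoc w (armLetter e (n - 1)), e, by rw [cellMap_snoc, letterMap_outer hn]⟩

theorem card_letter (n d : ℕ) : Fintype.card (Letter n d) = 2 ^ d * n - 2 ^ d + 1 := by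
  simp [Letter, Nat.mul_sub]

/-- The corner of a cell of level one, in the coordinates of that cell, that the cell shares with
its neighbor closer to the center; the central cell has none. -/
def innerCorner : Letter n d → Set (Fin d → ℝ)
  | none => ∅
  | some (i, _) => {corner (opposite i)}

theorem vertices_succ_eq_iUnion (hn : 2 ≤ n) (hd : 2 ≤ d) (m : ℕ) : vertices n d (m + 1) =
    ⋃ a : Letter n d, letterMap n d a '' (vertices n d m \ innerCorner a) := by
  ext x
  simp only [mem_vertices_succ hn, Set.mem_iUnion, Set.mem_image, Set.mem_sdiff]
  constructor
  · rintro ⟨a, v, hv, rfl⟩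
    by_cases hinner : v ∈ innerCorner a
    · rcases a with _ | ⟨i, r⟩
      · exact hinner.elim
      obtain rfl : v = corner (opposite i) := hinner
      refine ⟨armLetter i r, corner i, ⟨corner_mem_vertices hn m i, ?_⟩,
        (letterMap_opposite hn i r).symm⟩
      rcases (r : ℕ) with _ | k
      · exact id
      · rw [armLetter]
        split
        · exact fun h => opposite_ne hd i (corner_injective d h).symm
        · exact id
    · exact ⟨a, v, ⟨hv, hinner⟩, rfl⟩
  · rintro ⟨a, v, ⟨hv, -⟩, rfl⟩
    exact ⟨a, v, hv, rfl⟩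

theorem pairwise_disjoint_image_sdiff_innerCorner (hn : 2 ≤ n) (hd : 2 ≤ d) (m : ℕ) :
    Pairwise fun a b : Letter n d => Disjoint
      (letterMap n d a '' (vertices n d m \ innerCorner a))
      (letterMap n d b '' (vertices n d m \ innerCorner b)) := by
  intro a b hab
  wlog hrank : rank b ≤ rank a generalizing a b
  · exact (this hab.symm (Nat.le_of_not_le hrank)).symm
  rw [Set.disjoint_left]
  rintro _ ⟨x, ⟨hx, hinner⟩, rfl⟩ ⟨y, ⟨hy, -⟩, h⟩
  obtain ⟨i, r, rfl, -, hx', -⟩ := letterMap_eq_letterMap hn hd hab hrank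
    (vertices_subset_Icc hn m hx) (vertices_subset_Icc hn m hy) h.symm
  exact hinner hx'

theorem ncard_vertices_succ (hn : 2 ≤ n) (hd : 2 ≤ d) (m : ℕ) :
    (vertices n d (m + 1)).ncard =
      2 ^ d * (n - 1) * ((vertices n d m).ncard - 1) + (vertices n d m).ncard := by
  rw [vertices_succ_eq_iUnion hn hd, Set.ncard_iUnion_of_finite
    (fun a => (vertices_finite n d m).sdiff.image _)
    (pairwise_disjoint_image_sdiff_innerCorner hn hd m), finsum_eq_sum_of_fintype]
  simp only [Set.ncard_image_of_injective _ (letterMap_injective hn _), Fintype.sum_option,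
    innerCorner, Set.sdiff_empty, Set.ncard_sdiff_singleton_of_mem (corner_mem_vertices hn m _)]
  simp [add_comm]

theorem ncard_vertices (hn : 2 ≤ n) (hd : 2 ≤ d) (m : ℕ) :
    (vertices n d m).ncard = (2 ^ d * n - 2 ^ d + 1) ^ m * (2 ^ d - 1) + 1 := by
  induction m with
  | zero =>
    rw [vertices, ← Set.image_univ, Set.ncard_image_of_injective _ (corner_injective d),
      Set.ncard_univ]
    simp [Nat.sub_add_cancel Nat.one_le_two_pow]
  | succ m ih =>
    rw [ncard_vertices_succ hn hd, ih, Nat.add_sub_cancel, Nat.mul_sub, mul_one]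
    ring

theorem card_vertices (hn : 2 ≤ n) (hd : 2 ≤ d) (m : ℕ) :
    Fintype.card (vertices n d m) = (2 ^ d * n - 2 ^ d + 1) ^ m * (2 ^ d - 1) + 1 := by
  rw [← Nat.card_eq_fintype_card, Nat.card_coe_set_eq, ncard_vertices hn hd]

end Vertices

section Graph

variable {n d : ℕ}

/-- The vertex `e` of the cell of level `m` with address `w`. -/
def vert (hn : 2 ≤ n) (m : ℕ) (w : Fin m → Letter n d) (e : Fin d → Fin 2) : vertices n d m :=
  ⟨cellMap n d m w (corner e), (mem_vertices_iff hn).2 ⟨w, e, rfl⟩⟩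

theorem vert_eq_iff (hn : 2 ≤ n) {m : ℕ} {w w' : Fin m → Letter n d} {e e' : Fin d → Fin 2} :
    vert hn m w e = vert hn m w' e' ↔
      cellMap n d m w (corner e) = cellMap n d m w' (corner e') :=
  Subtype.ext_iff

theorem vert_injective (hn : 2 ≤ n) {m : ℕ} (w : Fin m → Letter n d) :
    Function.Injective (vert hn m w) := fun _ _ h =>
  corner_injective d (cellMap_injective hn w ((vert_eq_iff hn).1 h))

theorem exists_vert_eq (hn : 2 ≤ n) {m : ℕ} (x : vertices n d m) : ∃ w e, vert hn m w e = x := by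
  obtain ⟨w, e, h⟩ := (mem_vertices_iff hn).1 x.2
  exact ⟨w, e, Subtype.ext h⟩

theorem graph_adj_iff (hn : 2 ≤ n) {m : ℕ} {x y : vertices n d m} :
    (graph n d m).Adj x y ↔ ∃ w e e', e ≠ e' ∧ vert hn m w e = x ∧ vert hn m w e' = y := by
  simp only [graph, SimpleGraph.comap_adj, Function.Embedding.subtype_apply,
    SimpleGraph.fromEdgeSet_adj, mem_edges_iff hn]
  constructor
  · rintro ⟨⟨w, e, e', hne, h⟩, -⟩
    rcases Sym2.eq_iff.1 h with ⟨hx, hy⟩ | ⟨hx, hy⟩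
    · exact ⟨w, e, e', hne, Subtype.ext hx.symm, Subtype.ext hy.symm⟩
    · exact ⟨w, e', e, hne.symm, Subtype.ext hx.symm, Subtype.ext hy.symm⟩
  · rintro ⟨w, e, e', hne, rfl, rfl⟩
    exact ⟨⟨w, e, e', hne, rfl⟩, fun h => hne (vert_injective hn w (Subtype.ext h))⟩

theorem eq_of_vert_eq_of_vert_eq (hn : 2 ≤ n) (hd : 2 ≤ d) {m : ℕ} {w w' : Fin m → Letter n d}
    {e e' f f' : Fin d → Fin 2} (hne : e ≠ f) (he : vert hn m w e = vert hn m w' e')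
    (hf : vert hn m w f = vert hn m w' f') : w = w' := by
  by_contra hw
  obtain ⟨g, g', hg⟩ := exists_corners_of_cellMap_eq hn hd hw
  have heg := (hg _ (corner_mem_Icc e) _ (corner_mem_Icc e') ((vert_eq_iff hn).1 he)).1
  have hfg := (hg _ (corner_mem_Icc f) _ (corner_mem_Icc f') ((vert_eq_iff hn).1 hf)).1
  exact hne (corner_injective d (heg.trans hfg.symm))

/-- The decomposition of `G_m` into its cells of level `m`, which are complete graphs on `2 ^ d`
vertices. -/
def cliquePartition (hn : 2 ≤ n) (hd : 2 ≤ d) (m : ℕ) :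
    CliquePartition (graph n d m) (Fin m → Letter n d) (Fin d → Fin 2) where
  vert := vert hn m
  vert_injective := vert_injective hn
  exists_vert_eq := exists_vert_eq hn
  adj_iff := graph_adj_iff hn
  eq_of_common_edge := eq_of_vert_eq_of_vert_eq hn hd

theorem mem_eigenspace_iff_weakForm (hn : 2 ≤ n) (hd : 2 ≤ d) {m : ℕ} {μ : ℝ}
    {f : vertices n d m → ℝ} : f ∈ (-laplacian n d m).eigenspace μ ↔
      ∀ φ, (cliquePartition hn hd m).weakForm μ f φ = 0 := by
  classical
  have : NeZero d := ⟨by omega⟩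
  rw [CliquePartition.forall_weakForm_eq_zero_iff, Module.End.mem_eigenspace_iff, funext_iff]
  refine forall_congr' fun x => ?_
  have hdegree : ((graph n d m).degree x : ℝ) ≠ 0 :=
    Nat.cast_ne_zero.2 ((cliquePartition hn hd m).degree_pos x).ne'
  set s := ∑ y ∈ (graph n d m).neighborFinset x, f y
  calc (-laplacian n d m) f x = (μ • f) x
      ↔ ((graph n d m).degree x : ℝ)⁻¹ * s = (1 - μ) * f x := by
        simp only [LinearMap.neg_apply, Pi.neg_apply, Pi.smul_apply, smul_eq_mul, laplacian,
          LinearMap.coe_mk, AddHom.coe_mk]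
        constructor <;> intro h <;> linarith
    _ ↔ s = (1 - μ) * (graph n d m).degree x * f x := by
        rw [inv_mul_eq_iff_eq_mul₀ hdegree, mul_left_comm, mul_assoc]

theorem mem_neumannSpectrum_iff {m : ℕ} {μ : ℝ} :
    μ ∈ neumannSpectrum n d m ↔ (-laplacian n d m).HasEigenvalue μ := by
  refine ⟨fun ⟨f, hf, h⟩ => ?_, fun h => ?_⟩
  · exact Module.End.hasEigenvalue_of_hasEigenvector
      ⟨Module.End.mem_eigenspace_iff.2 (funext h), hf⟩
  · obtain ⟨f, hf, hne⟩ := h.exists_hasEigenvector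
    exact ⟨f, hne, congrFun (Module.End.mem_eigenspace_iff.1 hf)⟩

theorem one_le_neumannMultiplicity_zero (hn : 2 ≤ n) (hd : 2 ≤ d) (m : ℕ) :
    1 ≤ neumannMultiplicity n d m 0 := by
  refine Submodule.one_le_finrank_iff.2 ((Submodule.ne_bot_iff _).2 ⟨1, ?_, fun h => ?_⟩)
  · refine (mem_eigenspace_iff_weakForm hn hd).2 fun φ => ?_
    simp [CliquePartition.weakForm, CliquePartition.cellSum_apply]
  · exact one_ne_zero (congrFun h ⟨_, corner_mem_vertices hn m 0⟩)

theorem ker_cellSum_le_eigenspace_topValue (hn : 2 ≤ n) (hd : 2 ≤ d) (m : ℕ) :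
    ((cliquePartition hn hd m).cellSum ℝ).ker ≤ (-laplacian n d m).eigenspace (topValue d) := by
  intro f hf
  have hsum : (cliquePartition hn hd m).cellSum ℝ f = 0 := hf
  refine (mem_eigenspace_iff_weakForm hn hd).2 fun φ => ?_
  simp [CliquePartition.weakForm, hsum, mul_topValue hd]

theorem le_neumannMultiplicity_topValue (hn : 2 ≤ n) (hd : 2 ≤ d) (m : ℕ) :
    (2 ^ d * n - 2 ^ d + 1) ^ m * (2 ^ d - 2) + 1 ≤ neumannMultiplicity n d m (topValue d) := by
  have hcard := (cliquePartition hn hd m).card_le_card_add_finrank_ker_cellSum ℝ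
  rw [card_vertices hn hd, Fintype.card_fun, Fintype.card_fin, card_letter] at hcard
  have hker := Submodule.finrank_mono (ker_cellSum_le_eigenspace_topValue hn hd m)
  have hpow : 2 ^ d - 1 = 2 ^ d - 2 + 1 := by
    have := Nat.pow_le_pow_right two_pos (show 1 ≤ d by omega)
    omega
  rw [hpow, mul_add_one] at hcard
  rw [neumannMultiplicity]
  omega

end Graph

/-! ### Spectral decimation -/

section LocalExtension

open Polynomial.Chebyshev (U)

variable {n d : ℕ} {t : ℝ}

/-- The sum over the central cell of the extension of the corner values `b` at the regular value
with parameter `t`, divided by `2 ^ d - 1 + t`. -/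
def centerSum (n : ℕ) (t : ℝ) (b : (Fin d → Fin 2) → ℝ) : ℝ := (∑ e, b e) / topFactor (2 ^ d) n t

/-- The value at the corner `i` of the central cell of the extension of the corner values `b`. -/
def centerValue (n : ℕ) (t : ℝ) (b : (Fin d → Fin 2) → ℝ) (i : Fin d → Fin 2) : ℝ :=
  (b i + (1 + t) * (U ℝ ((n : ℤ) - 2)).eval t * centerSum n t b) / fourthKind n t

/-- The value of the extension of the corner values `b` at the outer vertex of the cell
`armLetter i k`. -/
def armVertex (n : ℕ) (t : ℝ) (b : (Fin d → Fin 2) → ℝ) (i : Fin d → Fin 2) (k : ℕ) : ℝ :=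
  ((U ℝ k).eval t + (U ℝ ((k : ℤ) - 1)).eval t) * centerValue n t b i
    - (1 + t) * (U ℝ ((k : ℤ) - 1)).eval t * centerSum n t b

/-- The value of the extension of the corner values `b` at the vertices of the cell `armLetter i k`
that belong to no other cell. -/
def armFree (n : ℕ) (t : ℝ) (b : (Fin d → Fin 2) → ℝ) (i : Fin d → Fin 2) (k : ℕ) : ℝ :=
  2 * (U ℝ ((k : ℤ) - 1)).eval t * centerValue n t b i
    + ((U ℝ k).eval t - (1 + 2 * t) * (U ℝ ((k : ℤ) - 1)).eval t) * centerSum n t b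

variable (n t) (b : (Fin d → Fin 2) → ℝ) (i : Fin d → Fin 2)

theorem armVertex_zero : armVertex n t b i 0 = centerValue n t b i := by
  simp [armVertex]

theorem armFree_zero : armFree n t b i 0 = centerSum n t b := by
  simp [armFree]

-- The two recurrences express that the eigenvalue equation holds at the vertices inside an arm.
theorem armFree_succ_add (k : ℕ) :
    armFree n t b i (k + 1) + armFree n t b i k = 2 * armVertex n t b i k := by
  simp only [armFree, armVertex]
  push_cast
  rw [add_sub_cancel_right, chebyshev_U_eval_add_one]
  ring

theorem armVertex_succ_add (k : ℕ) :
    armVertex n t b i (k + 1) + armVertex n t b i k = (1 + t) * armFree n t b i (k + 1) := by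
  simp only [armFree, armVertex]
  push_cast
  rw [add_sub_cancel_right, chebyshev_U_eval_add_one]
  ring

/-- The extension of the corner values `b` to the vertices of level one, in terms of addresses. -/
def localExt (n : ℕ) (t : ℝ) (b : (Fin d → Fin 2) → ℝ) : Letter n d → (Fin d → Fin 2) → ℝ
  | none, e => centerValue n t b e
  | some (i, r), e =>
    if e = i then armVertex n t b i (r + 1)
    else if e = opposite i then armVertex n t b i r
    else armFree n t b i (r + 1)

theorem localExt_armLetter {k : ℕ} (hk : k ≤ n - 1) :
    localExt n t b (armLetter i k) i = armVertex n t b i k := by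
  cases k with
  | zero => rw [armLetter, localExt, armVertex_zero]
  | succ k => simp [armLetter, localExt, show k < n - 1 by omega]

theorem localExt_opposite (hd : 2 ≤ d) (r : Fin (n - 1)) :
    localExt n t b (some (i, r)) (opposite i) = armVertex n t b i r := by
  simp [localExt, opposite_ne hd i]

theorem localExt_congr (hn : 2 ≤ n) (hd : 2 ≤ d) {a a' : Letter n d} {e e' : Fin d → Fin 2}
    (h : letterMap n d a (corner e) = letterMap n d a' (corner e')) :
    localExt n t b a e = localExt n t b a' e' := by
  by_cases ha : a = a'
  · subst ha
    rw [corner_injective d (letterMap_injective hn a h)]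
  wlog hrank : rank a' ≤ rank a generalizing a a' e e'
  · exact (this h.symm (Ne.symm ha) (Nat.le_of_not_le hrank)).symm
  obtain ⟨i, r, rfl, rfl, he, he'⟩ := letterMap_eq_letterMap hn hd ha hrank
    (corner_mem_Icc e) (corner_mem_Icc e') h
  rw [corner_injective d he, corner_injective d he', localExt_opposite n t b i hd,
    localExt_armLetter n t b i r.2.le]

variable {n t}

theorem armVertex_outer (hn : 2 ≤ n) (hW : fourthKind n t ≠ 0) :
    armVertex n t b i (n - 1) = b i := by
  have hvalue : fourthKind n t * centerValue n t b i =
      b i + (1 + t) * (U ℝ ((n : ℤ) - 2)).eval t * centerSum n t b := mul_div_cancel₀ _ hW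
  rw [fourthKind] at hvalue
  rw [armVertex, Nat.cast_sub (by omega : 1 ≤ n), Nat.cast_one, sub_sub, one_add_one_eq_two]
  linarith

theorem localExt_corner (hn : 2 ≤ n) (hd : 2 ≤ d) (hW : fourthKind n t ≠ 0) {a : Letter n d}
    {e e' : Fin d → Fin 2} (h : letterMap n d a (corner e) = corner e') :
    localExt n t b a e = b e' := by
  rw [localExt_congr n t b hn hd (h.trans (letterMap_outer hn e').symm),
    localExt_armLetter n t b e' le_rfl, armVertex_outer b e' hn hW]

theorem sum_localExt_none (hW : fourthKind n t ≠ 0) (hQ : topFactor (2 ^ d) n t ≠ 0) :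
    ∑ e, localExt n t b none e = (2 ^ d - 1 + t) * centerSum n t b := by
  have hsum : ∑ e, b e = topFactor (2 ^ d) n t * centerSum n t b := (mul_div_cancel₀ _ hQ).symm
  simp only [localExt, centerValue]
  rw [← Finset.sum_div, Finset.sum_add_distrib, hsum, div_eq_iff hW, topFactor, fourthKind]
  simp only [Finset.sum_const, Finset.card_univ, Fintype.card_fun, Fintype.card_fin, nsmul_eq_mul]
  push_cast
  ring

theorem sum_localExt_some (hd : 2 ≤ d) (r : Fin (n - 1)) :
    ∑ e, localExt n t b (some (i, r)) e = (2 ^ d - 1 + t) * armFree n t b i (r + 1) := by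
  have hdiff : ∑ e, (localExt n t b (some (i, r)) e - armFree n t b i (r + 1)) =
      (armVertex n t b i (r + 1) - armFree n t b i (r + 1)) +
        (armVertex n t b i r - armFree n t b i (r + 1)) := by
    rw [Fintype.sum_eq_add i (opposite i) (opposite_ne hd i).symm, localExt_opposite n t b i hd]
    · simp [localExt]
    · rintro e ⟨hi, hopp⟩
      simp [localExt, hi, hopp]
  simp only [Finset.sum_sub_distrib, Finset.sum_const, Finset.card_univ, Fintype.card_fun,
    Fintype.card_fin, nsmul_eq_mul] at hdiff
  push_cast at hdiff
  linear_combination hdiff + armVertex_succ_add n t b i r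

theorem armFree_outer_sub (hn : 2 ≤ n) (hW : fourthKind n t ≠ 0)
    (hQ : topFactor (2 ^ d) n t ≠ 0) :
    armFree n t b i (n - 1) - armVertex n t b i (n - 1) =
      (fourthKind n t * topFactor (2 ^ d) n t)⁻¹ *
        (∑ e, b e - thirdKind n t * topFactor (2 ^ d) n t * b i) := by
  have hpell := chebyshev_U_eval_sq_add_sq ((n : ℤ) - 1) t
  have hsum : ∑ e, b e = topFactor (2 ^ d) n t * centerSum n t b := (mul_div_cancel₀ _ hQ).symm
  have hvalue : fourthKind n t * centerValue n t b i =
      b i + (1 + t) * (U ℝ ((n : ℤ) - 2)).eval t * centerSum n t b := mul_div_cancel₀ _ hW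
  rw [armVertex_outer b i hn hW, hsum, eq_inv_mul_iff_mul_eq₀ (mul_ne_zero hW hQ), armFree,
    Nat.cast_sub (by omega : 1 ≤ n), Nat.cast_one]
  rw [sub_sub, one_add_one_eq_two] at hpell ⊢
  rw [thirdKind]
  rw [fourthKind] at hvalue ⊢
  linear_combination (2 * (U ℝ ((n : ℤ) - 2)).eval t * topFactor (2 ^ d) n t) * hvalue
    + centerSum n t b * topFactor (2 ^ d) n t * hpell

theorem sum_localExt_some_defect (hd : 2 ≤ d) (r : Fin (n - 1)) (φ : (Fin d → Fin 2) → ℝ) :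
    ∑ e, φ e * (∑ e', localExt n t b (some (i, r)) e'
        - (2 ^ d - 1 + t) * localExt n t b (some (i, r)) e) =
      (2 ^ d - 1 + t) * (φ i * (armFree n t b i (r + 1) - armVertex n t b i (r + 1))
        - φ (opposite i) * (armFree n t b i r - armVertex n t b i r)) := by
  rw [sum_localExt_some b i hd,
    Fintype.sum_eq_add i (opposite i) (opposite_ne hd i).symm, localExt_opposite n t b i hd]
  · simp only [localExt, if_true]
    linear_combination (2 ^ d - 1 + t) * φ (opposite i) * armFree_succ_add n t b i r
  · rintro e ⟨hi, hopp⟩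
    simp [localExt, hi, hopp]

-- Along each arm the defects telescope, so that only the outermost one survives.
theorem sum_localExt_defect (hn : 2 ≤ n) (hd : 2 ≤ d) (hW : fourthKind n t ≠ 0)
    (hQ : topFactor (2 ^ d) n t ≠ 0) {φ : Letter n d → (Fin d → Fin 2) → ℝ}
    (hφ : ∀ i r, φ (some (i, r)) (opposite i) = φ (armLetter i r) i) :
    ∑ a, ∑ e, φ a e * (∑ e', localExt n t b a e' - (2 ^ d - 1 + t) * localExt n t b a e) =
      (2 ^ d - 1 + t) * (fourthKind n t * topFactor (2 ^ d) n t)⁻¹ *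
        ∑ i, φ (armLetter i (n - 1)) i *
          (∑ e, b e - thirdKind n t * topFactor (2 ^ d) n t * b i) := by
  let flux (i : Fin d → Fin 2) (k : ℕ) : ℝ := (2 ^ d - 1 + t) *
    (φ (armLetter i k) i * (armFree n t b i k - armVertex n t b i k))
  have hnone : ∑ e, φ none e * (∑ e', localExt n t b none e'
      - (2 ^ d - 1 + t) * localExt n t b none e) = ∑ i, flux i 0 := by
    refine Finset.sum_congr rfl fun i _ => ?_
    rw [sum_localExt_none b hW hQ]
    simp only [flux, armFree_zero, armVertex_zero, localExt, armLetter]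
    ring
  have hsome (i : Fin d → Fin 2) (r : Fin (n - 1)) :
      ∑ e, φ (some (i, r)) e * (∑ e', localExt n t b (some (i, r)) e'
        - (2 ^ d - 1 + t) * localExt n t b (some (i, r)) e) = flux i (r + 1) - flux i r := by
    rw [sum_localExt_some_defect b i hd, hφ]
    simp only [flux, armLetter_succ, mul_sub]
  rw [Fintype.sum_option, hnone, Fintype.sum_prod_type, ← Finset.sum_add_distrib, Finset.mul_sum]
  refine Finset.sum_congr rfl fun i _ => ?_
  simp only [hsome]
  rw [← Finset.sum_range (fun k => flux i (k + 1) - flux i k), Finset.sum_range_sub]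
  simp only [flux, armFree_outer_sub b i hn hW hQ]
  ring

end LocalExtension

section Extension

variable {n d m : ℕ}

theorem localExt_vert_congr (hn : 2 ≤ n) (hd : 2 ≤ d) {t : ℝ} (hW : fourthKind n t ≠ 0)
    (f : vertices n d m → ℝ) {w w' : Fin m → Letter n d} {a a' : Letter n d}
    {e e' : Fin d → Fin 2}
    (h : vert hn (m + 1) (Fin.snoc w a) e = vert hn (m + 1) (Fin.snoc w' a') e') :
    localExt n t (f ∘ vert hn m w) a e = localExt n t (f ∘ vert hn m w') a' e' := by
  rw [vert_eq_iff, cellMap_snoc, cellMap_snoc] at h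
  by_cases hw : w = w'
  · subst hw
    exact localExt_congr n t _ hn hd (cellMap_injective hn w h)
  · obtain ⟨g, g', hg⟩ := exists_corners_of_cellMap_eq hn hd hw
    obtain ⟨ha, ha'⟩ := hg _ (letterMap_mem_Icc hn a (corner_mem_Icc e)) _
      (letterMap_mem_Icc hn a' (corner_mem_Icc e')) h
    rw [localExt_corner _ hn hd hW ha, localExt_corner _ hn hd hW ha']
    exact congrArg f ((vert_eq_iff hn).2 (by rw [← ha, ← ha', h]))

theorem exists_extension (hn : 2 ≤ n) (hd : 2 ≤ d) {t : ℝ} (hW : fourthKind n t ≠ 0)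
    (f : vertices n d m → ℝ) : ∃ g : vertices n d (m + 1) → ℝ,
      ∀ w a e, g (vert hn (m + 1) (Fin.snoc w a) e) = localExt n t (f ∘ vert hn m w) a e := by
  have haddress (y : vertices n d (m + 1)) :
      ∃ w a e, vert hn (m + 1) (Fin.snoc w a) e = y := by
    obtain ⟨w, e, h⟩ := exists_vert_eq hn y
    exact ⟨Fin.init w, w (Fin.last m), e, by rwa [Fin.snoc_init_self]⟩
  choose w a e hy using haddress
  exact ⟨fun y => localExt n t (f ∘ vert hn m (w y)) (a y) (e y),
    fun _ _ _ => localExt_vert_congr hn hd hW f (hy _)⟩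

theorem inclusion_vert (hn : 2 ≤ n) (w : Fin m → Letter n d) (e : Fin d → Fin 2) :
    Set.inclusion (vertices_subset_succ hn m) (vert hn m w e) =
      vert hn (m + 1) (Fin.snoc w (armLetter e (n - 1))) e :=
  Subtype.ext (by simp only [vert, cellMap_snoc, letterMap_outer hn])

theorem sum_snoc {α M : Type*} [Fintype α] [AddCommMonoid M] (F : (Fin (m + 1) → α) → M) :
    ∑ w, F w = ∑ w : Fin m → α, ∑ a, F (Fin.snoc w a) := by
  rw [← (Fin.snocEquiv fun _ => α).sum_comp, Fintype.sum_prod_type, Finset.sum_comm]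
  rfl

theorem weakForm_extension (hn : 2 ≤ n) (hd : 2 ≤ d) {x : ℝ} (hx : IsRegular n d x)
    {f : vertices n d m → ℝ} {g : vertices n d (m + 1) → ℝ}
    (hg : ∀ w a e, g (vert hn (m + 1) (Fin.snoc w a) e) =
      localExt n ((tPoly d).eval x) (f ∘ vert hn m w) a e) (φ : vertices n d (m + 1) → ℝ) :
    (cliquePartition hn hd (m + 1)).weakForm x g φ =
      (2 ^ d - 1 + (tPoly d).eval x) *
        (fourthKind n ((tPoly d).eval x) * topFactor (2 ^ d) n ((tPoly d).eval x))⁻¹ *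
        (cliquePartition hn hd m).weakForm ((decimation n d).eval x) f
          (φ ∘ Set.inclusion (vertices_subset_succ hn m)) := by
  have hcoeff : (2 : ℝ) ^ d - (2 ^ d - 1) * x = 2 ^ d - 1 + (tPoly d).eval x := by
    rw [eval_tPoly]
    ring
  have hcard : ((Fintype.card (Fin d → Fin 2) : ℕ) : ℝ) = 2 ^ d := by simp
  simp only [CliquePartition.weakForm, CliquePartition.cellSum_apply, cliquePartition, hcard,
    hcoeff, mul_decimation_eval, sub_sub_cancel, Function.comp_apply, inclusion_vert]
  rw [sum_snoc, Finset.mul_sum]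
  refine Finset.sum_congr rfl fun w _ => ?_
  have hφ (i : Fin d → Fin 2) (r : Fin (n - 1)) :
      φ (vert hn (m + 1) (Fin.snoc w (some (i, r))) (opposite i)) =
        φ (vert hn (m + 1) (Fin.snoc w (armLetter i r)) i) :=
    congrArg φ ((vert_eq_iff hn).2 (by rw [cellMap_snoc, cellMap_snoc, letterMap_opposite hn]))
  simp only [hg]
  exact sum_localExt_defect (f ∘ vert hn m w) hn hd hx.1 hx.2 hφ

theorem neumannMultiplicity_decimation_le (hn : 2 ≤ n) (hd : 2 ≤ d) (m : ℕ) {x : ℝ}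
    (hx : IsRegular n d x) :
    neumannMultiplicity n d m ((decimation n d).eval x) ≤ neumannMultiplicity n d (m + 1) x := by
  let restrict := LinearMap.funLeft ℝ ℝ (Set.inclusion (vertices_subset_succ (d := d) hn m))
  suffices hle : (-laplacian n d m).eigenspace ((decimation n d).eval x) ≤
      ((-laplacian n d (m + 1)).eigenspace x).map restrict from
    (Submodule.finrank_mono hle).trans (Submodule.finrank_map_le _ _)
  intro f hf
  obtain ⟨g, hg⟩ := exists_extension hn hd hx.1 f
  refine ⟨g, (mem_eigenspace_iff_weakForm hn hd).2 fun φ => ?_, funext fun y => ?_⟩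
  · rw [weakForm_extension hn hd hx hg, (mem_eigenspace_iff_weakForm hn hd).1 hf, mul_zero]
  · obtain ⟨w, e, rfl⟩ := exists_vert_eq hn y
    rw [LinearMap.funLeft_apply, inclusion_vert, hg,
      localExt_corner _ hn hd hx.1 (letterMap_outer hn e), Function.comp_apply]

end Extension

section Spectrum

variable {n d m : ℕ}

theorem neumannMultiplicity_seed_le (hn : 2 ≤ n) (hd : 2 ≤ d) {s : Bool} (m : ℕ)
    {v : List (Fin (2 * n - 1))} (hv : v ∈ admissible n s) :
    neumannMultiplicity n d m (seed d s) ≤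
      neumannMultiplicity n d (m + v.length) (branchWord n d v (seed d s)) := by
  induction v using List.reverseRecOn with
  | nil => exact le_rfl
  | append_singleton u l ih =>
    have hstep := neumannMultiplicity_decimation_le hn hd (m + u.length)
      (isRegular_branchWord_concat hn hd hv)
    rw [branchWord_concat,
      decimation_branch hn hd (branchWord_mem_Icc hn hd u (seed_mem_Icc hd s))] at hstep
    rw [branchWord_concat, List.length_append, List.length_singleton, ← add_assoc]
    exact (ih (mem_admissible_of_concat hv)).trans hstep

theorem predictedMultiplicity_le (hn : 2 ≤ n) (hd : 2 ≤ d) {s : Bool}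
    {v : List (Fin (2 * n - 1))} (hv : v ∈ admissible n s) (hm : v ∈ words n m) :
    predictedMultiplicity n d m s v.length ≤
      neumannMultiplicity n d m (branchWord n d v (seed d s)) := by
  have hseed := neumannMultiplicity_seed_le hn hd (m - v.length) hv
  rw [Nat.sub_add_cancel hm] at hseed
  refine le_trans ?_ hseed
  cases s with
  | true => exact le_neumannMultiplicity_topValue hn hd _
  | false => exact one_le_neumannMultiplicity_zero hn hd _

/-- The eigenvalues of `-Δ_m` described by the theorem, indexed without repetition. -/
def wordEigenvalue (n d m : ℕ) (p : Bool × WordIndex n m) : ℝ :=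
  branchWord n d (indexWord n m p.1 p.2) (seed d p.1)

theorem wordEigenvalue_injective (hn : 2 ≤ n) (hd : 2 ≤ d) (m : ℕ) :
    Function.Injective (wordEigenvalue n d m) := by
  rintro ⟨s, i⟩ ⟨s', i'⟩ h
  obtain ⟨rfl, hword⟩ := branchWord_seed_injective hn hd _ _ (indexWord_mem_admissible s i)
    (indexWord_mem_admissible s' i') h
  rw [indexWord_injective n m s hword]

theorem predictedMultiplicity_le_finrank (hn : 2 ≤ n) (hd : 2 ≤ d) (p : Bool × WordIndex n m) :
    predictedMultiplicity n d m p.1 (indexWord n m p.1 p.2).length ≤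
      Module.finrank ℝ ((-laplacian n d m).eigenspace (wordEigenvalue n d m p)) :=
  predictedMultiplicity_le hn hd (indexWord_mem_admissible p.1 p.2) (indexWord_mem_words p.1 p.2)

theorem finrank_eq_sum_predictedMultiplicity (hn : 2 ≤ n) (hd : 2 ≤ d) (m : ℕ) :
    Module.finrank ℝ (vertices n d m → ℝ) = ∑ p : Bool × WordIndex n m,
      predictedMultiplicity n d m p.1 (indexWord n m p.1 p.2).length := by
  rw [Module.finrank_fintype_fun_eq_card, card_vertices hn hd, sum_predictedMultiplicity hn hd]

theorem neumannMultiplicity_branchWord (hn : 2 ≤ n) (hd : 2 ≤ d) {s : Bool}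
    {v : List (Fin (2 * n - 1))} (hm : v ∈ words n m) (hv : v ∈ admissible n s) :
    neumannMultiplicity n d m (branchWord n d v (seed d s)) =
      predictedMultiplicity n d m s v.length := by
  obtain ⟨i, rfl⟩ := exists_indexWord_eq hn hv hm
  exact finrank_eigenspace_eq_of_finrank_le_sum (wordEigenvalue_injective hn hd m)
    (predictedMultiplicity_le_finrank hn hd)
    (finrank_eq_sum_predictedMultiplicity hn hd m).le (s, i)

theorem branchWord_mem_neumannSpectrum (hn : 2 ≤ n) (hd : 2 ≤ d) {s : Bool}
    {v : List (Fin (2 * n - 1))} (hm : v ∈ words n m) (hv : v ∈ admissible n s) :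
    branchWord n d v (seed d s) ∈ neumannSpectrum n d m := by
  refine mem_neumannSpectrum_iff.2 (Submodule.one_le_finrank_iff.1 ?_)
  refine le_trans ?_ (predictedMultiplicity_le hn hd hv hm)
  cases s <;> simp [predictedMultiplicity]

theorem mem_neumannSpectrum_iff_exists_branchWord (hn : 2 ≤ n) (hd : 2 ≤ d) {μ : ℝ} :
    μ ∈ neumannSpectrum n d m ↔
      ∃ s, ∃ v ∈ words n m, v ∈ admissible n s ∧ μ = branchWord n d v (seed d s) := by
  constructor
  · intro hμ
    obtain ⟨⟨s, i⟩, rfl⟩ := mem_range_of_hasEigenvalue (wordEigenvalue_injective hn hd m)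
      ((finrank_eq_sum_predictedMultiplicity hn hd m).trans_le
        (Finset.sum_le_sum fun p _ => predictedMultiplicity_le_finrank hn hd p))
      (mem_neumannSpectrum_iff.1 hμ)
    exact ⟨s, _, indexWord_mem_words s i, indexWord_mem_admissible s i, rfl⟩
  · rintro ⟨s, v, hm, hv, rfl⟩
    exact branchWord_mem_neumannSpectrum hn hd hm hv

end Spectrum

end Vicsek

end

theorem theorem4p2 (n d : ℕ) (hn : 2 ≤ n) (hd : 2 ≤ d) :
    -- the inverse branches are well defined on `[0, 2^d/(2^d-1)]`, with values in `[0, 1]`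
    (∀ y ∈ Set.Icc (0 : ℝ) ((2 : ℝ) ^ d / ((2 : ℝ) ^ d - 1)),
      StrictMono (fun l : Fin (2 * n - 1) => Vicsek.branch n d l y) ∧
      Set.range (fun l : Fin (2 * n - 1) => Vicsek.branch n d l y) =
        {x : ℝ | (Vicsek.decimation n d).eval x = y} ∧
      ∀ l : Fin (2 * n - 1), Vicsek.branch n d l y ∈ Set.Icc (0 : ℝ) 1) ∧
    ∀ m : ℕ,
      -- the Neumann spectrum
      Vicsek.neumannSpectrum n d m =
        {μ : ℝ | ∃ v ∈ Vicsek.words n m, v ∈ Vicsek.firstKind n ∧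
          μ = Vicsek.branchWord n d v ((2 : ℝ) ^ d / ((2 : ℝ) ^ d - 1))} ∪
        {μ : ℝ | ∃ v ∈ Vicsek.words n m, v ∈ Vicsek.secondKind n ∧
          μ = Vicsek.branchWord n d v 0} ∧
      -- the multiplicities
      (∀ v ∈ Vicsek.words n m, v ∈ Vicsek.firstKind n →
        Vicsek.neumannMultiplicity n d m
            (Vicsek.branchWord n d v ((2 : ℝ) ^ d / ((2 : ℝ) ^ d - 1))) =
          (2 ^ d * n - 2 ^ d + 1) ^ (m - v.length) * (2 ^ d - 2) + 1) ∧
      (∀ v ∈ Vicsek.words n m, v ∈ Vicsek.secondKind n →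
        Vicsek.neumannMultiplicity n d m (Vicsek.branchWord n d v 0) = 1) := by
  refine ⟨fun y hy => ⟨Vicsek.branch_strictMono hn hd hy, (Vicsek.branch_spec hn hd hy).2,
    Vicsek.branch_mem_Icc hn hd hy⟩, fun m => ⟨?_, ?_, ?_⟩⟩
  · ext μ
    rw [Vicsek.mem_neumannSpectrum_iff_exists_branchWord hn hd, Bool.exists_bool]
    exact or_comm
  · exact fun v hm hv => Vicsek.neumannMultiplicity_branchWord (s := true) hn hd hm hv
  · exact fun v hm hv => Vicsek.neumannMultiplicity_branchWord (s := false) hn hd hm hv
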